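/- Let $q\in(0,1)$. Let $\mathcal A=\mathcal O(SU_q(2))$ be the unital complex $*$-algebra generated by $a,b,c,d$ with relations $ab=qba$, $ac=qca$, $bd=qdb$, $cd=qdc$, $bc=cb$, $ad-qbc=1$, $da-q^{-1}bc=1$ and involution $a^*=d$, $b^*=-qc$. Let $\mathcal U=\mathcal U_q(su_2)$ be the unital complex algebra generated by $e,f,k,k^{-1}$ with relations $kk^{-1}=k^{-1}k=1$, $ke=qek$, $kf=q^{-1}fk$, $ef-fe=(k^2-k^{-2})/(q-q^{-1})$. Let $\partial:\mathcal U\to\mathrm{End}(\mathcal A)$ be the left action, i.e. the algebra homomorphism such that $\partial_k$ is an algebra automorphism with $\partial_k(a)=q^{1/2}a$, $\partial_k(b)=q^{-1/2}b$, $\partial_k(c)=q^{1/2}c$, $\partial_k(d)=q^{-1/2}d$, such that $\partial_g(xy)=\partial_g(x)\partial_{k^{-1}}(y)+\partial_k(x)\partial_g(y)$ for $g\in\{e,f\}$ and $x,y\in\mathcal A$, and such that $\partial_e(a)=\partial_e(c)=0$, $\partial_e(b)=a$, $\partial_e(d)=c$, $\partial_f(b)=\partial_f(d)=0$, $\partial_f(a)=b$,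 $\partial_f(c)=d$. Put $\sigma_L=\partial_{k^2}\in\mathrm{Aut}(\mathcal A)$ (the left modular automorphism). Let $h$ be the Haar state, i.e. the unique linear functional on $\mathcal A$ with $h(1)=1$, $h(x^*x)\ge 0$ and $(\mathrm{id}\otimes h)\Delta(x)=h(x)1=(h\otimes\mathrm{id})\Delta(x)$ for all $x$, where $\Delta$ is the coproduct of $\mathcal A$. Let $\mathcal H_h$ be its GNS space, the completion of $\mathcal A$ for $\langle x,y\rangle=h(x^*y)$. On $\mathcal H_h$ each $x\in\mathcal A$ acts as a bounded operator by left multiplication, and on $\mathcal H=\mathcal H_h\oplus\mathcal H_h$ it acts diagonally; these operators are again denoted by $x$. For $g\in\mathcal U$ regard $\partial_g$ as an unbounded operator on $\mathcal H_h$ with domain $\mathcal A$, and let the $q$-Dirac operator $D_q$ be the closure of the operator $$D=\begin{pmatrix}(q-q^{-1})^{-1}(q^{-1}\partial_{k^2}-1) & q^{1/2}\,\partial_{ek}\\ q^{-1/2}\,\partial_{fk} & (q-q^{-1})^{-1}(1-q\,\partial_{k^2})\end{pmatrix}:\mathcal A\oplus\mathcal A\to\mathcal H .$$ Then for every $x\in\mathcal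 A$ the twisted commutator $D_q x-\sigma_L(x)D_q$ extends to a bounded operator on $\mathcal H$: its natural domain $\{\xi\in\mathrm{Dom}(D_q): x\xi\in\mathrm{Dom}(D_q)\}$ is equal to $\mathrm{Dom}(D_q)$, which is dense in $\mathcal H$, and on this domain $$D_q x-\sigma_L(x)D_q=\begin{pmatrix}(q-q^{-1})^{-1}\,\partial_{k^2-1}(x) & q^{1/2}\,\partial_{ek}(x)\\ q^{-1/2}\,\partial_{fk}(x) & -(q-q^{-1})^{-1}\,\partial_{k^2-1}(x)\end{pmatrix},$$ where the entries of the matrix, which are elements of $\mathcal A$, act on $\mathcal H_h$ by left multiplication. -/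

import Mathlib

/-!
The coordinate algebra of quantum `SU(2)`, its left action by the quantised enveloping algebra,
the Haar state with its GNS space, and the `q`-Dirac operator.
-/

set_option linter.unusedSectionVars false

namespace SUq2

open scoped TensorProduct ComplexConjugate
open MulOpposite

/-! ### The coordinate `*`-algebra -/

/-- The symbols `a, b, c, d`. -/
inductive Gen
  | a | b | c | d

/-- The defining relations of the coordinate algebra, for elements `a, b, c, d` of a complex
algebra. -/
structure Relations (q : ℝ) {B : Type*} [Ring B] [Algebra ℂ B] (a b c d : B) : Prop where
  ab : a * b = (q : ℂ) • (b * a)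
  ac : a * c = (q : ℂ) • (c * a)
  bd : b * d = (q : ℂ) • (d * b)
  cd : c * d = (q : ℂ) • (d * c)
  bc : b * c = c * b
  ad : a * d - (q : ℂ) • (b * c) = 1
  da : d * a - (q : ℂ)⁻¹ • (b * c) = 1

/-- The same relations between words in the free algebra. -/
inductive Rel (q : ℝ) : FreeAlgebra ℂ Gen → FreeAlgebra ℂ Gen → Prop
  | ab : Rel q (FreeAlgebra.ι ℂ Gen.a * FreeAlgebra.ι ℂ Gen.b)
      ((q : ℂ) • (FreeAlgebra.ι ℂ Gen.b * FreeAlgebra.ι ℂ Gen.a))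
  | ac : Rel q (FreeAlgebra.ι ℂ Gen.a * FreeAlgebra.ι ℂ Gen.c)
      ((q : ℂ) • (FreeAlgebra.ι ℂ Gen.c * FreeAlgebra.ι ℂ Gen.a))
  | bd : Rel q (FreeAlgebra.ι ℂ Gen.b * FreeAlgebra.ι ℂ Gen.d)
      ((q : ℂ) • (FreeAlgebra.ι ℂ Gen.d * FreeAlgebra.ι ℂ Gen.b))
  | cd : Rel q (FreeAlgebra.ι ℂ Gen.c * FreeAlgebra.ι ℂ Gen.d)
      ((q : ℂ) • (FreeAlgebra.ι ℂ Gen.d * FreeAlgebra.ι ℂ Gen.c))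
  | bc : Rel q (FreeAlgebra.ι ℂ Gen.b * FreeAlgebra.ι ℂ Gen.c)
      (FreeAlgebra.ι ℂ Gen.c * FreeAlgebra.ι ℂ Gen.b)
  | ad : Rel q (FreeAlgebra.ι ℂ Gen.a * FreeAlgebra.ι ℂ Gen.d
      - (q : ℂ) • (FreeAlgebra.ι ℂ Gen.b * FreeAlgebra.ι ℂ Gen.c)) 1
  | da : Rel q (FreeAlgebra.ι ℂ Gen.d * FreeAlgebra.ι ℂ Gen.a
      - (q : ℂ)⁻¹ • (FreeAlgebra.ι ℂ Gen.b * FreeAlgebra.ι ℂ Gen.c)) 1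

/-- The coordinate algebra `O(SU_q(2))`: the unital complex algebra generated by `a, b, c, d`
subject to the relations above. -/
def OSUq (q : ℝ) : Type := RingQuot (Rel q)

noncomputable instance (q : ℝ) : Ring (OSUq q) := inferInstanceAs (Ring (RingQuot (Rel q)))
noncomputable instance (q : ℝ) : Algebra ℂ (OSUq q) :=
  inferInstanceAs (Algebra ℂ (RingQuot (Rel q)))

namespace OSUq

/-- The quotient map from the free algebra. -/
noncomputable def mk (q : ℝ) : FreeAlgebra ℂ Gen →ₐ[ℂ] OSUq q := RingQuot.mkAlgHom ℂ (Rel q)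

noncomputable def a (q : ℝ) : OSUq q := mk q (FreeAlgebra.ι ℂ Gen.a)
noncomputable def b (q : ℝ) : OSUq q := mk q (FreeAlgebra.ι ℂ Gen.b)
noncomputable def c (q : ℝ) : OSUq q := mk q (FreeAlgebra.ι ℂ Gen.c)
noncomputable def d (q : ℝ) : OSUq q := mk q (FreeAlgebra.ι ℂ Gen.d)

theorem rel (q : ℝ) : Relations q (a q) (b q) (c q) (d q) := by
  constructor <;> simp only [a, b, c, d, ← map_mul, ← map_smul, ← map_sub]
  · exact RingQuot.mkAlgHom_rel ℂ Rel.ab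
  · exact RingQuot.mkAlgHom_rel ℂ Rel.ac
  · exact RingQuot.mkAlgHom_rel ℂ Rel.bd
  · exact RingQuot.mkAlgHom_rel ℂ Rel.cd
  · exact RingQuot.mkAlgHom_rel ℂ Rel.bc
  · rw [← map_one (mk q)]; exact RingQuot.mkAlgHom_rel ℂ Rel.ad
  · rw [← map_one (mk q)]; exact RingQuot.mkAlgHom_rel ℂ Rel.da

/-- The universal property: elements satisfying the relations define an algebra homomorphism. -/
noncomputable def lift {q : ℝ} {B : Type*} [Ring B] [Algebra ℂ B] {a' b' c' d' : B}
    (h : Relations q a' b' c' d') : OSUq q →ₐ[ℂ] B :=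
  RingQuot.liftAlgHom ℂ ⟨FreeAlgebra.lift ℂ
    (fun g => match g with | Gen.a => a' | Gen.b => b' | Gen.c => c' | Gen.d => d'), by
      intro x y hxy
      cases hxy <;> simp only [map_mul, map_smul, map_sub, map_one, FreeAlgebra.lift_ι_apply]
      exacts [h.ab, h.ac, h.bd, h.cd, h.bc, h.ad, h.da]⟩

section
variable {q : ℝ} {B : Type*} [Ring B] [Algebra ℂ B] {a' b' c' d' : B}
  (h : Relations q a' b' c' d')

@[simp] theorem lift_a : lift h (a q) = a' := by
  unfold lift a mk; erw [RingQuot.liftAlgHom_mkAlgHom_apply]; simp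
@[simp] theorem lift_b : lift h (b q) = b' := by
  unfold lift b mk; erw [RingQuot.liftAlgHom_mkAlgHom_apply]; simp
@[simp] theorem lift_c : lift h (c q) = c' := by
  unfold lift c mk; erw [RingQuot.liftAlgHom_mkAlgHom_apply]; simp
@[simp] theorem lift_d : lift h (d q) = d' := by
  unfold lift d mk; erw [RingQuot.liftAlgHom_mkAlgHom_apply]; simp
end

/-- Induction over words in the generators. -/
theorem induction {q : ℝ} {P : OSUq q → Prop} (smul : ∀ (t : ℂ) (x : OSUq q), P x → P (t • x))
    (one : P 1) (ha : P (a q)) (hb : P (b q)) (hc : P (c q)) (hd : P (d q))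
    (mul : ∀ x y, P x → P y → P (x * y)) (add : ∀ x y, P x → P y → P (x + y))
    (x : OSUq q) : P x := by
  obtain ⟨w, rfl⟩ : ∃ w, mk q w = x := RingQuot.mkAlgHom_surjective ℂ (Rel q) x
  induction w using FreeAlgebra.induction with
  | grade0 r =>
    rw [AlgHom.commutes, Algebra.algebraMap_eq_smul_one]
    exact smul _ _ one
  | grade1 g => cases g <;> assumption
  | mul u v hu hv => rw [map_mul]; exact mul _ _ hu hv
  | add u v hu hv => rw [map_add]; exact add _ _ hu hv

theorem algHom_ext {q : ℝ} {B : Type*} [Ring B] [Algebra ℂ B] {f g : OSUq q →ₐ[ℂ] B}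
    (ha : f (a q) = g (a q)) (hb : f (b q) = g (b q)) (hc : f (c q) = g (c q))
    (hd : f (d q) = g (d q)) : f = g := by
  ext x
  induction x using OSUq.induction with
  | smul t x hx => simp [hx]
  | one => simp
  | ha => exact ha
  | hb => exact hb
  | hc => exact hc
  | hd => exact hd
  | mul x y hx hy => simp [hx, hy]
  | add x y hx hy => simp [hx, hy]

end OSUq

open OSUq

/-- The opposite algebra with conjugated scalars: an algebra homomorphism into it is a
conjugate-linear antimultiplicative map. -/
def ConjOp (B : Type*) : Type _ := Bᵐᵒᵖ

namespace ConjOp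
variable {B : Type*}

/-- The identity map from an algebra to its conjugate opposite. -/
def mk (x : B) : ConjOp B := op x

/-- The identity map from the conjugate opposite to the algebra. -/
def val (x : ConjOp B) : B := unop x

theorem val_mk (x : B) : val (mk x) = x := rfl

noncomputable instance [Ring B] : Ring (ConjOp B) := inferInstanceAs (Ring Bᵐᵒᵖ)

noncomputable instance [Ring B] [Algebra ℂ B] : Algebra ℂ (ConjOp B) :=
  Algebra.compHom (A := Bᵐᵒᵖ) (starRingEnd ℂ)

variable [Ring B] [Algebra ℂ B]
theorem val_smul (t : ℂ) (x : ConjOp B) : val (t • x) = conj t • val x := rfl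
theorem val_mul (x y : ConjOp B) : val (x * y) = val y * val x := rfl
theorem val_add (x y : ConjOp B) : val (x + y) = val x + val y := rfl
theorem val_sub (x y : ConjOp B) : val (x - y) = val x - val y := rfl
theorem val_one : val (1 : ConjOp B) = 1 := rfl
theorem val_inj {x y : ConjOp B} (h : val x = val y) : x = y := unop_injective h
end ConjOp

section
variable (q : ℝ) [hq : Fact (0 < q ∧ q < 1)]

theorem q_ne : (q : ℂ) ≠ 0 := by exact_mod_cast hq.out.1.ne'

theorem star_relations : Relations q (ConjOp.mk (d q)) (ConjOp.mk (-(q : ℂ) • c q))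
    (ConjOp.mk (-(q : ℂ)⁻¹ • b q)) (ConjOp.mk (a q)) := by
  have h := rel q
  have hq := q_ne q
  constructor <;> apply ConjOp.val_inj <;>
    simp only [ConjOp.val_smul, ConjOp.val_mul, ConjOp.val_sub, ConjOp.val_one, ConjOp.val_mk,
      smul_mul_assoc, mul_smul_comm, smul_smul, Complex.conj_ofReal, map_inv₀,
      h.ab, h.ac, h.bd, h.cd, h.bc]
  · module
  · module
  · module
  · module
  · congr 1; ring
  · rw [← h.ad, ← h.bc]; congr 2; field_simp
  · rw [← h.da, ← h.bc]; congr 2; field_simp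

/-- The conjugate-linear antimultiplicative map with `a ↦ d`, `b ↦ -q c`, `c ↦ -q⁻¹ b`,
`d ↦ a`. -/
noncomputable def starHom : OSUq q →ₐ[ℂ] ConjOp (OSUq q) := OSUq.lift (star_relations q)

/-- The involution, determined by `a* = d` and `b* = -q c`. -/
noncomputable instance : Star (OSUq q) := ⟨fun x => ConjOp.val (starHom q x)⟩

theorem star_def (x : OSUq q) : star x = ConjOp.val (starHom q x) := rfl
theorem star_a : star (a q) = d q := by simp [star_def, starHom, ConjOp.val_mk]
theorem star_b : star (b q) = -(q : ℂ) • c q := by simp [star_def, starHom, ConjOp.val_mk]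
theorem star_c : star (c q) = -(q : ℂ)⁻¹ • b q := by simp [star_def, starHom, ConjOp.val_mk]
theorem star_d : star (d q) = a q := by simp [star_def, starHom, ConjOp.val_mk]
theorem star_smul' (t : ℂ) (x : OSUq q) : star (t • x) = conj t • star x := by
  simp only [star_def, map_smul, ConjOp.val_smul]
theorem star_mul' (x y : OSUq q) : star (x * y) = star y * star x := by
  simp only [star_def, map_mul, ConjOp.val_mul]
theorem star_add' (x y : OSUq q) : star (x + y) = star x + star y := by
  simp only [star_def, map_add, ConjOp.val_add]
theorem star_one' : star (1 : OSUq q) = 1 := by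
  simp only [star_def, map_one, ConjOp.val_one]

theorem star_star' (x : OSUq q) : star (star x) = x := by
  have hq := q_ne q
  induction x using OSUq.induction with
  | smul t x hx => simp [star_smul', hx]
  | one => simp [star_one']
  | ha => rw [star_a, star_d]
  | hb => rw [star_b, star_smul', star_c, smul_smul]; simp [hq]
  | hc => rw [star_c, star_smul', star_b, smul_smul]; simp [hq]
  | hd => rw [star_d, star_a]
  | mul x y hx hy => rw [star_mul', star_mul', hx, hy]
  | add x y hx hy => rw [star_add', star_add', hx, hy]

noncomputable instance : StarRing (OSUq q) where
  star_involutive := star_star' q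
  star_mul := star_mul' q
  star_add := star_add' q

instance : StarModule ℂ (OSUq q) := ⟨star_smul' q⟩

end

/-! ### The quantised enveloping algebra and its left action -/

/-- The symbols `e, f, k, k⁻¹`. -/
inductive UGen
  | e | f | k | kinv

/-- The defining relations of `U_q(su_2)`, for elements `e, f, k, k⁻¹` of a complex algebra. -/
structure URelations (q : ℝ) {B : Type*} [Ring B] [Algebra ℂ B] (e f k k' : B) : Prop where
  kinv_k : k' * k = 1
  k_kinv : k * k' = 1
  ke : k * e = (q : ℂ) • (e * k)
  kf : k * f = (q : ℂ)⁻¹ • (f * k)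
  ef : e * f - f * e = ((q : ℂ) - (q : ℂ)⁻¹)⁻¹ • (k ^ 2 - k' ^ 2)

/-- The same relations between words in the free algebra. -/
inductive URel (q : ℝ) : FreeAlgebra ℂ UGen → FreeAlgebra ℂ UGen → Prop
  | kinv_k : URel q (FreeAlgebra.ι ℂ UGen.kinv * FreeAlgebra.ι ℂ UGen.k) 1
  | k_kinv : URel q (FreeAlgebra.ι ℂ UGen.k * FreeAlgebra.ι ℂ UGen.kinv) 1
  | ke : URel q (FreeAlgebra.ι ℂ UGen.k * FreeAlgebra.ι ℂ UGen.e)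
      ((q : ℂ) • (FreeAlgebra.ι ℂ UGen.e * FreeAlgebra.ι ℂ UGen.k))
  | kf : URel q (FreeAlgebra.ι ℂ UGen.k * FreeAlgebra.ι ℂ UGen.f)
      ((q : ℂ)⁻¹ • (FreeAlgebra.ι ℂ UGen.f * FreeAlgebra.ι ℂ UGen.k))
  | ef : URel q (FreeAlgebra.ι ℂ UGen.e * FreeAlgebra.ι ℂ UGen.f
        - FreeAlgebra.ι ℂ UGen.f * FreeAlgebra.ι ℂ UGen.e)
      (((q : ℂ) - (q : ℂ)⁻¹)⁻¹ •
        (FreeAlgebra.ι ℂ UGen.k ^ 2 - FreeAlgebra.ι ℂ UGen.kinv ^ 2))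

/-- The unital complex algebra `U_q(su_2)` generated by `e, f, k, k⁻¹` subject to the relations
above. -/
def Uq (q : ℝ) : Type := RingQuot (URel q)

noncomputable instance (q : ℝ) : Ring (Uq q) := inferInstanceAs (Ring (RingQuot (URel q)))
noncomputable instance (q : ℝ) : Algebra ℂ (Uq q) :=
  inferInstanceAs (Algebra ℂ (RingQuot (URel q)))

namespace Uq

/-- The quotient map from the free algebra. -/
noncomputable def mk (q : ℝ) : FreeAlgebra ℂ UGen →ₐ[ℂ] Uq q := RingQuot.mkAlgHom ℂ (URel q)

noncomputable def e (q : ℝ) : Uq q := mk q (FreeAlgebra.ι ℂ UGen.e)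
noncomputable def f (q : ℝ) : Uq q := mk q (FreeAlgebra.ι ℂ UGen.f)
noncomputable def k (q : ℝ) : Uq q := mk q (FreeAlgebra.ι ℂ UGen.k)
noncomputable def kinv (q : ℝ) : Uq q := mk q (FreeAlgebra.ι ℂ UGen.kinv)

theorem rel (q : ℝ) : URelations q (e q) (f q) (k q) (kinv q) := by
  constructor <;> simp only [e, f, k, kinv, ← map_mul, ← map_smul, ← map_sub, ← map_pow]
  · rw [← map_one (mk q)]; exact RingQuot.mkAlgHom_rel ℂ URel.kinv_k
  · rw [← map_one (mk q)]; exact RingQuot.mkAlgHom_rel ℂ URel.k_kinv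
  · exact RingQuot.mkAlgHom_rel ℂ URel.ke
  · exact RingQuot.mkAlgHom_rel ℂ URel.kf
  · exact RingQuot.mkAlgHom_rel ℂ URel.ef

/-- The universal property: elements satisfying the relations define an algebra homomorphism. -/
noncomputable def lift {q : ℝ} {B : Type*} [Ring B] [Algebra ℂ B] {e' f' k' l' : B}
    (h : URelations q e' f' k' l') : Uq q →ₐ[ℂ] B :=
  RingQuot.liftAlgHom ℂ ⟨FreeAlgebra.lift ℂ
    (fun g => match g with | UGen.e => e' | UGen.f => f' | UGen.k => k' | UGen.kinv => l'), by
      intro x y hxy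
      cases hxy <;> simp only [map_mul, map_smul, map_sub, map_one, map_pow,
        FreeAlgebra.lift_ι_apply]
      exacts [h.kinv_k, h.k_kinv, h.ke, h.kf, h.ef]⟩

section
variable {q : ℝ} {B : Type*} [Ring B] [Algebra ℂ B] {e' f' k' l' : B}
  (h : URelations q e' f' k' l')

@[simp] theorem lift_e : lift h (e q) = e' := by
  unfold lift e mk; erw [RingQuot.liftAlgHom_mkAlgHom_apply]; simp
@[simp] theorem lift_f : lift h (f q) = f' := by
  unfold lift f mk; erw [RingQuot.liftAlgHom_mkAlgHom_apply]; simp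
@[simp] theorem lift_k : lift h (k q) = k' := by
  unfold lift k mk; erw [RingQuot.liftAlgHom_mkAlgHom_apply]; simp
@[simp] theorem lift_kinv : lift h (kinv q) = l' := by
  unfold lift kinv mk; erw [RingQuot.liftAlgHom_mkAlgHom_apply]; simp
end

end Uq

section
variable (q : ℝ) [hq : Fact (0 < q ∧ q < 1)]

/-- The number `q^{1/2}` as a complex scalar. -/
noncomputable def qHalf : ℂ := ((√q : ℝ) : ℂ)

theorem qHalf_mul : (q : ℂ) = qHalf q * qHalf q := by
  rw [qHalf, ← Complex.ofReal_mul, Real.mul_self_sqrt hq.out.1.le]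

theorem qHalf_ne : qHalf q ≠ 0 := by
  rw [qHalf]; exact_mod_cast (Real.sqrt_pos.2 hq.out.1).ne'

theorem torus_relations {u v : ℂ} (hu : u ≠ 0) (hv : v ≠ 0) :
    Relations q (u • a q) (v⁻¹ • b q) (v • c q) (u⁻¹ • d q) := by
  have h := rel q
  constructor <;> simp only [smul_mul_assoc, mul_smul_comm, smul_smul, h.ab, h.ac, h.bd, h.cd]
  · congr 1; ring
  · congr 1; ring
  · congr 1; ring
  · congr 1; ring
  · rw [h.bc]; congr 1; ring
  · rw [← h.ad, h.bc]; congr 1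
    · rw [inv_mul_cancel₀ hu, one_smul]
    · congr 1; field_simp
  · rw [← h.da, h.bc]; congr 1
    · rw [mul_inv_cancel₀ hu, one_smul]
    · congr 1; field_simp

/-- The algebra endomorphism `a ↦ u a`, `b ↦ v⁻¹ b`, `c ↦ v c`, `d ↦ u⁻¹ d`. -/
noncomputable def torus {u v : ℂ} (hu : u ≠ 0) (hv : v ≠ 0) : OSUq q →ₐ[ℂ] OSUq q :=
  OSUq.lift (torus_relations q hu hv)

/-- The action of `k`: the algebra endomorphism with
`a ↦ q^{1/2} a`, `b ↦ q^{-1/2} b`, `c ↦ q^{1/2} c`, `d ↦ q^{-1/2} d`. -/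
noncomputable def actK : OSUq q →ₐ[ℂ] OSUq q := torus q (qHalf_ne q) (qHalf_ne q)

/-- The action of `k⁻¹`. -/
noncomputable def actKinv : OSUq q →ₐ[ℂ] OSUq q :=
  torus q (inv_ne_zero (qHalf_ne q)) (inv_ne_zero (qHalf_ne q))

theorem actE_relations : Relations q (B := Matrix (Fin 2) (Fin 2) (OSUq q))
    !![qHalf q • a q, 0; 0, (qHalf q)⁻¹ • a q] !![(qHalf q)⁻¹ • b q, a q; 0, qHalf q • b q]
    !![qHalf q • c q, 0; 0, (qHalf q)⁻¹ • c q] !![(qHalf q)⁻¹ • d q, c q; 0, qHalf q • d q] := by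
  obtain ⟨hab, hac, hbd, hcd, hbc, had, hda⟩ := rel q
  have hs := qHalf_ne q
  have had' : a q * d q = 1 + (q : ℂ) • (b q * c q) := by rw [← had]; abel
  have hda' : d q * a q = 1 + (q : ℂ)⁻¹ • (b q * c q) := by rw [← hda]; abel
  simp only [hbc] at had' hda'
  have hqs := qHalf_mul q
  generalize qHalf q = s at *
  rw [hqs] at hab hac hbd hcd had' hda'
  constructor <;> (try rw [hqs]) <;> ext i j <;> fin_cases i <;> fin_cases j <;>
    simp [hab, hac, hbd, hcd, hbc, had', hda', smul_smul] <;>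
    match_scalars <;> (try field_simp) <;> (try ring)

theorem actF_relations : Relations q (B := Matrix (Fin 2) (Fin 2) (OSUq q))
    !![qHalf q • a q, b q; 0, (qHalf q)⁻¹ • a q] !![(qHalf q)⁻¹ • b q, 0; 0, qHalf q • b q]
    !![qHalf q • c q, d q; 0, (qHalf q)⁻¹ • c q] !![(qHalf q)⁻¹ • d q, 0; 0, qHalf q • d q] := by
  obtain ⟨hab, hac, hbd, hcd, hbc, had, hda⟩ := rel q
  have hs := qHalf_ne q
  have had' : a q * d q = 1 + (q : ℂ) • (b q * c q) := by rw [← had]; abel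
  have hda' : d q * a q = 1 + (q : ℂ)⁻¹ • (b q * c q) := by rw [← hda]; abel
  simp only [hbc] at had' hda'
  have hqs := qHalf_mul q
  generalize qHalf q = s at *
  rw [hqs] at hab hac hbd hcd had' hda'
  constructor <;> (try rw [hqs]) <;> ext i j <;> fin_cases i <;> fin_cases j <;>
    simp [hab, hac, hbd, hcd, hbc, had', hda', smul_smul] <;>
    match_scalars <;> (try field_simp) <;> (try ring)

end

section
variable (q : ℝ) [hq : Fact (0 < q ∧ q < 1)]

/-- The algebra homomorphism `x ↦ [[k(x), e(x)], [0, k⁻¹(x)]]` on the coordinate algebra.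
Multiplicativity is the rule `e(xy) = e(x) k⁻¹(y) + k(x) e(y)`. -/
noncomputable def matE : OSUq q →ₐ[ℂ] Matrix (Fin 2) (Fin 2) (OSUq q) :=
  OSUq.lift (actE_relations q)

/-- The algebra homomorphism `x ↦ [[k(x), f(x)], [0, k⁻¹(x)]]` on the coordinate algebra. -/
noncomputable def matF : OSUq q →ₐ[ℂ] Matrix (Fin 2) (Fin 2) (OSUq q) :=
  OSUq.lift (actF_relations q)

/-- The action of `e`: it sends `b ↦ a`, `d ↦ c`, `a, c ↦ 0`. -/
noncomputable def actE : OSUq q →ₗ[ℂ] OSUq q :=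
  Matrix.entryLinearMap ℂ (OSUq q) 0 1 ∘ₗ (matE q).toLinearMap

/-- The action of `f`: it sends `a ↦ b`, `c ↦ d`, `b, d ↦ 0`. -/
noncomputable def actF : OSUq q →ₗ[ℂ] OSUq q :=
  Matrix.entryLinearMap ℂ (OSUq q) 0 1 ∘ₗ (matF q).toLinearMap

section
variable {q}
@[simp] theorem torus_a {u v : ℂ} (hu : u ≠ 0) (hv : v ≠ 0) : torus q hu hv (a q) = u • a q := by
  simp [torus]
@[simp] theorem torus_b {u v : ℂ} (hu : u ≠ 0) (hv : v ≠ 0) : torus q hu hv (b q) = v⁻¹ • b q := by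
  simp [torus]
@[simp] theorem torus_c {u v : ℂ} (hu : u ≠ 0) (hv : v ≠ 0) : torus q hu hv (c q) = v • c q := by
  simp [torus]
@[simp] theorem torus_d {u v : ℂ} (hu : u ≠ 0) (hv : v ≠ 0) : torus q hu hv (d q) = u⁻¹ • d q := by
  simp [torus]
end

@[simp] theorem actK_a : actK q (a q) = qHalf q • a q := by simp [actK]
@[simp] theorem actK_b : actK q (b q) = (qHalf q)⁻¹ • b q := by simp [actK]
@[simp] theorem actK_c : actK q (c q) = qHalf q • c q := by simp [actK]
@[simp] theorem actK_d : actK q (d q) = (qHalf q)⁻¹ • d q := by simp [actK]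
@[simp] theorem actKinv_a : actKinv q (a q) = (qHalf q)⁻¹ • a q := by simp [actKinv]
@[simp] theorem actKinv_b : actKinv q (b q) = qHalf q • b q := by simp [actKinv]
@[simp] theorem actKinv_c : actKinv q (c q) = (qHalf q)⁻¹ • c q := by simp [actKinv]
@[simp] theorem actKinv_d : actKinv q (d q) = qHalf q • d q := by simp [actKinv]
@[simp] theorem actE_a : actE q (a q) = 0 := by simp [actE, matE]
@[simp] theorem actE_b : actE q (b q) = a q := by simp [actE, matE]
@[simp] theorem actE_c : actE q (c q) = 0 := by simp [actE, matE]
@[simp] theorem actE_d : actE q (d q) = c q := by simp [actE, matE]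
@[simp] theorem actF_a : actF q (a q) = b q := by simp [actF, matF]
@[simp] theorem actF_b : actF q (b q) = 0 := by simp [actF, matF]
@[simp] theorem actF_c : actF q (c q) = d q := by simp [actF, matF]
@[simp] theorem actF_d : actF q (d q) = 0 := by simp [actF, matF]
@[simp] theorem actE_one : actE q 1 = 0 := by simp [actE]
@[simp] theorem actF_one : actF q 1 = 0 := by simp [actF]

theorem matE_eq (x : OSUq q) :
    matE q x = !![actK q x, actE q x; 0, actKinv q x] := by
  have h : matE q x 0 0 = actK q x ∧ matE q x 1 0 = 0 ∧ matE q x 1 1 = actKinv q x := by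
    induction x using OSUq.induction with
    | smul t x hx => simp [hx]
    | one => simp
    | ha => simp [matE]
    | hb => simp [matE]
    | hc => simp [matE]
    | hd => simp [matE]
    | mul x y hx hy => simp [Matrix.mul_apply, Fin.sum_univ_two, hx, hy]
    | add x y hx hy => simp [hx, hy]
  ext i j
  fin_cases i <;> fin_cases j <;> simp [h, actE]

theorem matF_eq (x : OSUq q) :
    matF q x = !![actK q x, actF q x; 0, actKinv q x] := by
  have h : matF q x 0 0 = actK q x ∧ matF q x 1 0 = 0 ∧ matF q x 1 1 = actKinv q x := by
    induction x using OSUq.induction with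
    | smul t x hx => simp [hx]
    | one => simp
    | ha => simp [matF]
    | hb => simp [matF]
    | hc => simp [matF]
    | hd => simp [matF]
    | mul x y hx hy => simp [Matrix.mul_apply, Fin.sum_univ_two, hx, hy]
    | add x y hx hy => simp [hx, hy]
  ext i j
  fin_cases i <;> fin_cases j <;> simp [h, actF]

/-- The twisted Leibniz rule for `e`. -/
theorem actE_mul (x y : OSUq q) :
    actE q (x * y) = actE q x * actKinv q y + actK q x * actE q y := by
  have h := congrFun (congrFun (map_mul (matE q) x y) 0) 1
  simpa [matE_eq, Matrix.mul_apply, Fin.sum_univ_two, add_comm] using h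

/-- The twisted Leibniz rule for `f`. -/
theorem actF_mul (x y : OSUq q) :
    actF q (x * y) = actF q x * actKinv q y + actK q x * actF q y := by
  have h := congrFun (congrFun (map_mul (matF q) x y) 0) 1
  simpa [matF_eq, Matrix.mul_apply, Fin.sum_univ_two, add_comm] using h

theorem actKinv_actK (x : OSUq q) : actKinv q (actK q x) = x := by
  have : (actKinv q).comp (actK q) = AlgHom.id ℂ _ := by
    apply OSUq.algHom_ext <;> simp [smul_smul, qHalf_ne]
  exact congrArg (fun f : OSUq q →ₐ[ℂ] OSUq q => f x) this

theorem actK_actKinv (x : OSUq q) : actK q (actKinv q x) = x := by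
  have : (actK q).comp (actKinv q) = AlgHom.id ℂ _ := by
    apply OSUq.algHom_ext <;> simp [smul_smul, qHalf_ne]
  exact congrArg (fun f : OSUq q →ₐ[ℂ] OSUq q => f x) this

theorem actK_actE (x : OSUq q) : actK q (actE q x) = (q : ℂ) • actE q (actK q x) := by
  have hs := qHalf_ne q
  rw [qHalf_mul q]
  induction x using OSUq.induction with
  | smul t x hx => simp only [map_smul, hx, smul_comm t]
  | one => simp
  | ha => simp
  | hb => simp [smul_smul, hs]
  | hc => simp
  | hd => simp [smul_smul, hs]
  | mul x y hx hy =>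
    simp only [map_mul, actE_mul, map_add, hx, hy, actKinv_actK, actK_actKinv, smul_add,
      smul_mul_assoc, mul_smul_comm]
  | add x y hx hy => simp only [map_add, hx, hy, smul_add]

theorem actK_actF (x : OSUq q) : actK q (actF q x) = (q : ℂ)⁻¹ • actF q (actK q x) := by
  have hs := qHalf_ne q
  rw [qHalf_mul q, mul_inv]
  induction x using OSUq.induction with
  | smul t x hx => simp only [map_smul, hx, smul_comm t]
  | one => simp
  | ha => simp [smul_smul, hs]
  | hb => simp
  | hc => simp [smul_smul, hs]
  | hd => simp
  | mul x y hx hy =>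
    simp only [map_mul, actF_mul, map_add, hx, hy, actKinv_actK, actK_actKinv, smul_add,
      smul_mul_assoc, mul_smul_comm]
  | add x y hx hy => simp only [map_add, hx, hy, smul_add]

theorem actE_actKinv (x : OSUq q) : actE q (actKinv q x) = (q : ℂ) • actKinv q (actE q x) := by
  have h := actK_actE q (actKinv q x)
  rw [actK_actKinv] at h
  rw [← actKinv_actK q (actE q (actKinv q x)), h, map_smul]

theorem actF_actKinv (x : OSUq q) :
    actF q (actKinv q x) = (q : ℂ)⁻¹ • actKinv q (actF q x) := by
  have h := actK_actF q (actKinv q x)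
  rw [actK_actKinv] at h
  rw [← actKinv_actK q (actF q (actKinv q x)), h, map_smul]

theorem act_ef (x : OSUq q) : actE q (actF q x) - actF q (actE q x) =
    ((q : ℂ) - (q : ℂ)⁻¹)⁻¹ • (actK q (actK q x) - actKinv q (actKinv q x)) := by
  have hs := qHalf_ne q
  have hqne := q_ne q
  have hq2 : (q : ℂ) - (q : ℂ)⁻¹ ≠ 0 := by
    intro h
    have h1 : (q : ℂ) * q = 1 := by
      rw [sub_eq_zero] at h
      nth_rewrite 2 [h]
      exact mul_inv_cancel₀ hqne
    have h2 : q * q = 1 := by exact_mod_cast h1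
    nlinarith [hq.out.1, hq.out.2]
  have e1 : ((q : ℂ) - (q : ℂ)⁻¹)⁻¹ * (qHalf q * qHalf q - (qHalf q)⁻¹ * (qHalf q)⁻¹) = 1 := by
    rw [← mul_inv, ← qHalf_mul]; exact inv_mul_cancel₀ hq2
  have e2 : ((q : ℂ) - (q : ℂ)⁻¹)⁻¹ * ((qHalf q)⁻¹ * (qHalf q)⁻¹ - qHalf q * qHalf q) = -1 := by
    rw [← e1]; ring
  induction x using OSUq.induction with
  | smul t x hx => simp only [map_smul, ← smul_sub, hx, smul_comm t]
  | one => simp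
  | ha => simp only [actF_a, actE_b, actE_a, actK_a, actKinv_a, map_smul, map_zero, smul_smul,
      ← sub_smul, e1, sub_zero, one_smul]
  | hb => simp only [actF_a, actE_b, actF_b, actK_b, actKinv_b, map_smul, map_zero, smul_smul,
      ← sub_smul, e2, zero_sub, neg_smul, one_smul]
  | hc => simp only [actF_c, actE_d, actE_c, actK_c, actKinv_c, map_smul, map_zero, smul_smul,
      ← sub_smul, e1, sub_zero, one_smul]
  | hd => simp only [actF_c, actE_d, actF_d, actK_d, actKinv_d, map_smul, map_zero, smul_smul,
      ← sub_smul, e2, zero_sub, neg_smul, one_smul]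
  | mul x y hx hy =>
    have key : actE q (actF q (x * y)) - actF q (actE q (x * y)) =
        (actE q (actF q x) - actF q (actE q x)) * actKinv q (actKinv q y) +
        actK q (actK q x) * (actE q (actF q y) - actF q (actE q y)) := by
      simp only [actE_mul, actF_mul, map_add, actK_actE, actK_actF, actE_actKinv, actF_actKinv,
        smul_mul_assoc, mul_smul_comm, mul_sub, sub_mul, smul_smul, mul_inv_cancel₀ hqne,
        inv_mul_cancel₀ hqne, one_smul]
      abel
    rw [key, hx, hy]
    simp only [map_mul, smul_mul_assoc, mul_smul_comm, mul_sub, sub_mul, smul_sub]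
    abel
  | add x y hx hy =>
    simp only [map_add]
    rw [add_sub_add_comm, hx, hy, ← smul_add]
    congr 1
    abel

theorem act_relations : URelations q (B := Module.End ℂ (OSUq q))
    (actE q) (actF q) (actK q).toLinearMap (actKinv q).toLinearMap where
  kinv_k := by ext x; simp [actKinv_actK]
  k_kinv := by ext x; simp [actK_actKinv]
  ke := by ext x; exact actK_actE q x
  kf := by ext x; exact actK_actF q x
  ef := by ext x; simpa [pow_two, -Complex.coe_smul] using act_ef q x

/-- The left action `∂` of `U_q(su_2)` on the coordinate algebra. It is the algebra homomorphism
for which `∂_k` is multiplicative, `∂_e` and `∂_f` obey the twisted Leibniz rules, and which on the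
fundamental corepresentation `[[a, b], [c, d]]` lowers (`e`) and raises (`f`) the column index. -/
noncomputable def leftAction : Uq q →ₐ[ℂ] Module.End ℂ (OSUq q) := Uq.lift (act_relations q)

theorem leftAction_e : leftAction q (Uq.e q) = actE q := by simp [leftAction]
theorem leftAction_f : leftAction q (Uq.f q) = actF q := by simp [leftAction]
theorem leftAction_k : leftAction q (Uq.k q) = (actK q).toLinearMap := by simp [leftAction]
theorem leftAction_kinv : leftAction q (Uq.kinv q) = (actKinv q).toLinearMap := by
  simp [leftAction]

theorem leftAction_k_sq (x : OSUq q) : leftAction q (Uq.k q ^ 2) x = actK q (actK q x) := by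
  simp [leftAction_k, pow_two]

theorem leftAction_kinv_sq (x : OSUq q) :
    leftAction q (Uq.kinv q ^ 2) x = actKinv q (actKinv q x) := by
  simp [leftAction_kinv, pow_two]

/-- The left modular automorphism `σ_L = ∂_{k²}`. -/
noncomputable def sigmaL : OSUq q ≃ₐ[ℂ] OSUq q where
  toFun := leftAction q (Uq.k q ^ 2)
  invFun := leftAction q (Uq.kinv q ^ 2)
  left_inv x := by simp only [leftAction_k_sq, leftAction_kinv_sq, actKinv_actK]
  right_inv x := by simp only [leftAction_k_sq, leftAction_kinv_sq, actK_actKinv]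
  map_mul' x y := by simp only [leftAction_k_sq, map_mul]
  map_add' x y := map_add _ x y
  commutes' t := by simp only [leftAction_k_sq, AlgHom.commutes]

theorem sigmaL_apply (x : OSUq q) : sigmaL q x = leftAction q (Uq.k q ^ 2) x := rfl

end

/-! ### The coproduct and the Haar state -/

section
variable (q : ℝ) [hq : Fact (0 < q ∧ q < 1)]

theorem coproduct_relations : Relations q (B := OSUq q ⊗[ℂ] OSUq q)
    (a q ⊗ₜ a q + b q ⊗ₜ c q) (a q ⊗ₜ b q + b q ⊗ₜ d q)
    (c q ⊗ₜ a q + d q ⊗ₜ c q) (c q ⊗ₜ b q + d q ⊗ₜ d q) := by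
  obtain ⟨hab, hac, hbd, hcd, hbc, had, hda⟩ := rel q
  have hqne := q_ne q
  have had' : a q * d q = 1 + (q : ℂ) • (b q * c q) := by rw [← had]; abel
  have hda' : d q * a q = 1 + (q : ℂ)⁻¹ • (b q * c q) := by rw [← hda]; abel
  constructor <;>
    simp only [mul_add, add_mul, Algebra.TensorProduct.tmul_mul_tmul, hab, hac, hbd, hcd, had',
      hda', hbc, TensorProduct.tmul_add, TensorProduct.add_tmul, TensorProduct.tmul_smul,
      ← TensorProduct.smul_tmul', smul_add, smul_smul, Algebra.TensorProduct.one_def]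
  all_goals match_scalars <;> (try field_simp) <;> (try ring)

/-- The coproduct, `Δ(a) = a ⊗ a + b ⊗ c`, `Δ(b) = a ⊗ b + b ⊗ d`, `Δ(c) = c ⊗ a + d ⊗ c`,
`Δ(d) = c ⊗ b + d ⊗ d`. -/
noncomputable def coproduct : OSUq q →ₐ[ℂ] OSUq q ⊗[ℂ] OSUq q :=
  OSUq.lift (coproduct_relations q)

end

section
open scoped ComplexOrder
variable (q : ℝ) [hq : Fact (0 < q ∧ q < 1)]

/-- A functional on the coordinate algebra is positive if `h(x* x) ≥ 0` for all `x`. -/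
def IsPos (h : OSUq q →ₗ[ℂ] ℂ) : Prop := ∀ x, 0 ≤ h (star x * x)

/-- The Haar state: the bi-invariant state `h`, that is, `h(1) = 1`, `h(x* x) ≥ 0`,
`(id ⊗ h)Δ(x) = h(x) 1` and `(h ⊗ id)Δ(x) = h(x) 1`. -/
structure IsHaarState (h : OSUq q →ₗ[ℂ] ℂ) : Prop where
  map_one : h 1 = 1
  pos : IsPos q h
  id_conv : ∀ x, TensorProduct.rid ℂ (OSUq q) (h.lTensor (OSUq q) (coproduct q x)) = h x • 1
  conv_id : ∀ x, TensorProduct.lid ℂ (OSUq q) (h.rTensor (OSUq q) (coproduct q x)) = h x • 1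

variable {q}

theorem IsPos.map_star {h : OSUq q →ₗ[ℂ] ℂ} (hh : IsPos q h) (x : OSUq q) :
    h (star x) = conj (h x) := by
  have key : ∀ y : OSUq q, (h (star y * y)).im = 0 := fun y => (Complex.nonneg_iff.1 (hh y)).2.symm
  have h0 := key x
  have h00 := key 1
  have h1 := key (1 + x)
  have h2 := key (1 + Complex.I • x)
  simp only [star_add, star_one, star_smul, mul_add, add_mul, one_mul, mul_one, map_add, map_smul,
    smul_mul_assoc, mul_smul_comm, Complex.add_im, smul_eq_mul, Complex.star_def,
    Complex.conj_I, Complex.mul_im, Complex.I_re, Complex.I_im, Complex.neg_re, Complex.neg_im,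
    Complex.mul_re] at h0 h00 h1 h2
  apply Complex.ext <;> simp only [Complex.conj_re, Complex.conj_im] <;> linarith

/-- Left multiplication by `x` is bounded for the seminorm of any positive functional. -/
theorem exists_bound (x : OSUq q) : ∃ C : ℝ, 0 ≤ C ∧ ∀ h : OSUq q →ₗ[ℂ] ℂ, IsPos q h →
    ∀ y, (h (star (x * y) * (x * y))).re ≤ C * (h (star y * y)).re := by
  have hqne := q_ne q
  have hre : ∀ h : OSUq q →ₗ[ℂ] ℂ, IsPos q h → ∀ y, 0 ≤ (h (star y * y)).re :=
    fun h hh y => (Complex.nonneg_iff.1 (hh y)).1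
  have hsum : ∀ u v : OSUq q, star u * u + star v * v = 1 →
      ∀ h : OSUq q →ₗ[ℂ] ℂ, IsPos q h → ∀ y, (h (star (u * y) * (u * y))).re +
        (h (star (v * y) * (v * y))).re = (h (star y * y)).re := by
    intro u v huv h hh y
    rw [← Complex.add_re, ← map_add]
    congr 2
    calc star (u * y) * (u * y) + star (v * y) * (v * y)
        = star y * (star u * u + star v * v) * y := by simp only [star_mul]; noncomm_ring
      _ = _ := by rw [huv, mul_one]
  have hac : star (a q) * a q + star (c q) * c q = 1 := by
    rw [star_a, star_c, ← (rel q).da]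
    simp [sub_eq_add_neg, -Complex.coe_smul]
  have hdb : star (d q) * d q + star (b q) * b q = 1 := by
    rw [star_d, star_b, ← (rel q).ad, (rel q).bc]
    simp [sub_eq_add_neg, -Complex.coe_smul]
  induction x using OSUq.induction with
  | smul t x hx =>
    obtain ⟨C, hC, H⟩ := hx
    refine ⟨Complex.normSq t * C, mul_nonneg (Complex.normSq_nonneg _) hC, fun h hh y => ?_⟩
    have e : star (t • x * y) * (t • x * y) = (Complex.normSq t : ℂ) • (star (x * y) * (x * y)) := by
      rw [Complex.normSq_eq_conj_mul_self]
      simp only [smul_mul_assoc, star_smul, mul_smul_comm, smul_smul, Complex.star_def, mul_comm t]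
    rw [e, map_smul, smul_eq_mul, Complex.re_ofReal_mul, mul_assoc]
    exact mul_le_mul_of_nonneg_left (H h hh y) (Complex.normSq_nonneg _)
  | one => exact ⟨1, zero_le_one, fun h hh y => by simp⟩
  | ha => exact ⟨1, zero_le_one, fun h hh y => by
      have := hsum _ _ hac h hh y; have := hre h hh (c q * y); linarith⟩
  | hb => exact ⟨1, zero_le_one, fun h hh y => by
      have := hsum _ _ hdb h hh y; have := hre h hh (d q * y); linarith⟩
  | hc => exact ⟨1, zero_le_one, fun h hh y => by
      have := hsum _ _ hac h hh y; have := hre h hh (a q * y); linarith⟩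
  | hd => exact ⟨1, zero_le_one, fun h hh y => by
      have := hsum _ _ hdb h hh y; have := hre h hh (b q * y); linarith⟩
  | mul x x' hx hx' =>
    obtain ⟨C, hC, H⟩ := hx
    obtain ⟨C', hC', H'⟩ := hx'
    refine ⟨C * C', mul_nonneg hC hC', fun h hh y => ?_⟩
    rw [mul_assoc x, mul_assoc C]
    exact (H h hh _).trans (mul_le_mul_of_nonneg_left (H' h hh y) hC)
  | add x x' hx hx' =>
    obtain ⟨C, hC, H⟩ := hx
    obtain ⟨C', hC', H'⟩ := hx'
    refine ⟨2 * C + 2 * C', by positivity, fun h hh y => ?_⟩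
    have e : star ((x + x') * y) * ((x + x') * y) + star ((x - x') * y) * ((x - x') * y) =
        (star (x * y) * (x * y) + star (x * y) * (x * y)) +
          (star (x' * y) * (x' * y) + star (x' * y) * (x' * y)) := by
      simp only [add_mul, sub_mul, star_add, star_sub, mul_add, mul_sub]; abel
    have e' := congrArg (fun w => (h w).re) e
    simp only [map_add, Complex.add_re] at e'
    have h1 := hre h hh ((x - x') * y)
    have h2 := H h hh y
    have h3 := H' h hh y
    linarith

end
/-! ### Existence of the Haar state

The state is obtained from the irreducible representations of the coordinate algebra on
`ℓ²(ℕ × ℤ)`; its bi-invariance is deduced from its invariance under the left action. -/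

section
variable (q : ℝ) [hq : Fact (0 < q ∧ q < 1)]

/-- The weight `(1 - q^{2k})^{1/2}`. -/
noncomputable def wt (k : ℕ) : ℂ := ((√(1 - q ^ (2 * k)) : ℝ) : ℂ)

theorem wt_zero : wt q 0 = 0 := by simp [wt]

theorem wt_sq (k : ℕ) : wt q k * wt q k = 1 - (q : ℂ) ^ (2 * k) := by
  have h : (0 : ℝ) ≤ 1 - q ^ (2 * k) := sub_nonneg.2 (pow_le_one₀ hq.out.1.le hq.out.2.le)
  rw [wt, ← Complex.ofReal_mul, Real.mul_self_sqrt h]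
  push_cast
  rfl

theorem conj_wt (k : ℕ) : conj (wt q k) = wt q k := by simp [wt]

/-- A weighted shift on finitely supported functions. -/
noncomputable def shift (t : ℕ × ℤ → ℂ) (s : ℕ × ℤ → ℕ × ℤ) : Module.End ℂ (ℕ × ℤ →₀ ℂ) :=
  Finsupp.linearCombination ℂ (fun i => Finsupp.single (s i) (t i))

theorem shift_single (t : ℕ × ℤ → ℂ) (s : ℕ × ℤ → ℕ × ℤ) (i : ℕ × ℤ) (r : ℂ) :
    shift t s (Finsupp.single i r) = Finsupp.single (s i) (r * t i) := by
  simp [shift, Finsupp.linearCombination_single]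

theorem rep_relations : Relations q
    (shift (fun i => wt q i.1) (fun i => (i.1 - 1, i.2)))
    (shift (fun i => -(q : ℂ) ^ (i.1 + 1)) (fun i => (i.1, i.2 - 1)))
    (shift (fun i => (q : ℂ) ^ i.1) (fun i => (i.1, i.2 + 1)))
    (shift (fun i => wt q (i.1 + 1)) (fun i => (i.1 + 1, i.2))) := by
  have hqne := q_ne q
  constructor <;> apply Finsupp.lhom_ext <;> rintro ⟨k, n⟩ r <;>
    simp only [Module.End.mul_apply, LinearMap.smul_apply, LinearMap.sub_apply, Module.End.one_apply,
      shift_single, Finsupp.smul_single, smul_eq_mul, Nat.add_sub_cancel, sub_add_cancel,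
      add_sub_cancel_right, ← Finsupp.single_sub]
  · rcases k with _ | k
    · simp [wt_zero]
    · simp only [Nat.add_sub_cancel]; congr 1; ring
  · rcases k with _ | k
    · simp [wt_zero]
    · simp only [Nat.add_sub_cancel]; congr 1; ring
  · congr 1; ring
  · congr 1; ring
  · congr 1; ring
  · congr 1
    have := wt_sq q (k + 1)
    linear_combination r * this
  · rcases k with _ | k
    · simp only [wt_zero, mul_zero, zero_mul, Finsupp.single_zero, zero_sub,
        ← Finsupp.single_neg, Nat.zero_sub]
      congr 1; field_simp; ring
    · simp only [Nat.add_sub_cancel]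
      rw [← Finsupp.single_sub]
      congr 1
      have := wt_sq q (k + 1)
      field_simp
      linear_combination q * r * this

/-- The representation on finitely supported functions on `ℕ × ℤ`. -/
noncomputable def rep : OSUq q →ₐ[ℂ] Module.End ℂ (ℕ × ℤ →₀ ℂ) := OSUq.lift (rep_relations q)

/-- The inner product of finitely supported functions. -/
noncomputable def form (u v : ℕ × ℤ →₀ ℂ) : ℂ := u.sum fun i t => conj t * v i

theorem form_single_left (i : ℕ × ℤ) (t : ℂ) (v : ℕ × ℤ →₀ ℂ) :
    form (Finsupp.single i t) v = conj t * v i := by simp [form]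

theorem form_add_left (u u' v : ℕ × ℤ →₀ ℂ) : form (u + u') v = form u v + form u' v := by
  simp only [form]
  exact Finsupp.sum_add_index' (by simp) (by intros; rw [map_add, add_mul])

theorem form_smul_left (t : ℂ) (u v : ℕ × ℤ →₀ ℂ) : form (t • u) v = conj t * form u v := by
  simp only [form]
  rw [Finsupp.sum_smul_index (by simp), Finsupp.mul_sum]
  simp only [map_mul, mul_assoc]

theorem form_add_right (u v v' : ℕ × ℤ →₀ ℂ) : form u (v + v') = form u v + form u v' := by
  simp only [form, Finsupp.add_apply, mul_add, Finsupp.sum_add]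

theorem form_smul_right (t : ℂ) (u v : ℕ × ℤ →₀ ℂ) : form u (t • v) = t * form u v := by
  simp only [form, Finsupp.smul_apply, smul_eq_mul, Finsupp.mul_sum]
  congr 1; ext i s; ring

theorem form_zero_left (v : ℕ × ℤ →₀ ℂ) : form 0 v = 0 := by simp [form]
theorem form_zero_right (u : ℕ × ℤ →₀ ℂ) : form u 0 = 0 := by simp [form]

theorem form_ext (S T : Module.End ℂ (ℕ × ℤ →₀ ℂ))
    (h : ∀ i j, form (S (Finsupp.single i 1)) (Finsupp.single j 1) =
      form (Finsupp.single i 1) (T (Finsupp.single j 1))) (u v : ℕ × ℤ →₀ ℂ) :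
    form (S u) v = form u (T v) := by
  induction u using Finsupp.induction_linear with
  | zero => simp [form_zero_left]
  | add u u' hu hu' => rw [map_add, form_add_left, form_add_left, hu, hu']
  | single i r =>
    induction v using Finsupp.induction_linear with
    | zero => simp [form_zero_right]
    | add v v' hv hv' => rw [map_add, form_add_right, form_add_right, hv, hv']
    | single j t =>
      rw [← mul_one r, ← mul_one t, ← smul_eq_mul, ← smul_eq_mul, ← Finsupp.smul_single,
        ← Finsupp.smul_single, map_smul, map_smul, form_smul_left, form_smul_right,
        form_smul_right, form_smul_left, h]
      ring

theorem form_rep (x : OSUq q) (u v : ℕ × ℤ →₀ ℂ) :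
    form (rep q (star x) u) v = form u (rep q x v) := by
  have hqne := q_ne q
  have hqr : ∀ k : ℕ, conj ((q : ℂ) ^ k) = (q : ℂ) ^ k := by simp
  induction x using OSUq.induction generalizing u v with
  | smul t x hx => simp [form_smul_left, form_smul_right, hx]
  | one => simp
  | ha =>
    apply form_ext
    rintro ⟨k, n⟩ ⟨k', n'⟩
    simp only [star_a, rep, OSUq.lift_d, OSUq.lift_a, shift_single, form_single_left, map_one,
      conj_wt, one_mul, Finsupp.single_apply, Prod.mk.injEq]
    rcases k' with _ | k'
    · simp [wt_zero]
    · by_cases h : k' = k <;> by_cases h' : n' = n <;> simp [h, h']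
  | hd =>
    apply form_ext
    rintro ⟨k, n⟩ ⟨k', n'⟩
    simp only [star_d, rep, OSUq.lift_d, OSUq.lift_a, shift_single, form_single_left, map_one,
      conj_wt, one_mul, Finsupp.single_apply, Prod.mk.injEq]
    rcases k with _ | k
    · simp [wt_zero]
    · by_cases h : k' = k <;> by_cases h' : n' = n <;> simp [h, h']
  | hb =>
    apply form_ext
    rintro ⟨k, n⟩ ⟨k', n'⟩
    simp only [star_b, map_smul, LinearMap.smul_apply, Finsupp.smul_single, rep, OSUq.lift_b,
      OSUq.lift_c, shift_single, form_single_left, map_mul, map_one, hqr, map_neg, smul_eq_mul,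
      Complex.conj_ofReal, one_mul, Finsupp.single_apply, Prod.mk.injEq]
    by_cases h : k' = k <;> by_cases h' : n' = n + 1
    · subst h h'; simp; ring
    · have : ¬ (n' - 1 = n) := by omega
      simp [h', this]
    · simp [h]
    · simp [h]
  | hc =>
    apply form_ext
    rintro ⟨k, n⟩ ⟨k', n'⟩
    simp only [star_c, map_smul, LinearMap.smul_apply, Finsupp.smul_single, rep, OSUq.lift_b,
      OSUq.lift_c, shift_single, form_single_left, map_mul, map_one, hqr, map_neg, smul_eq_mul,
      Complex.conj_ofReal, one_mul, Finsupp.single_apply, Prod.mk.injEq, map_inv₀]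
    by_cases h : k' = k <;> by_cases h' : n' + 1 = n
    · subst h h'; simp; field_simp; ring
    · have : ¬ (n' = n - 1) := by omega
      simp [h', this]
    · simp [h]
    · simp [h]
  | mul x y hx hy =>
    rw [star_mul, map_mul, map_mul, Module.End.mul_apply, Module.End.mul_apply, hy, hx]
  | add x y hx hy =>
    simp only [star_add, map_add, LinearMap.add_apply, form_add_left, form_add_right, hx, hy]

/-- The diagonal matrix coefficient at `(k, 0)`. -/
noncomputable def diag (k : ℕ) : OSUq q →ₗ[ℂ] ℂ :=
  Finsupp.lapply (k, 0) ∘ₗ LinearMap.applyₗ (Finsupp.single (k, 0) 1) ∘ₗ (rep q).toLinearMap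

theorem diag_apply (k : ℕ) (x : OSUq q) :
    diag q k x = rep q x (Finsupp.single (k, 0) 1) (k, 0) := rfl

theorem diag_star_mul (k : ℕ) (x : OSUq q) : diag q k (star x * x) =
    ((rep q x (Finsupp.single (k, 0) 1)).sum fun _ t => Complex.normSq t : ℝ) := by
  have h : diag q k (star x * x) = form (rep q x (Finsupp.single (k, 0) 1))
      (rep q x (Finsupp.single (k, 0) 1)) := by
    have h1 := form_rep q (star x) (Finsupp.single (k, 0) 1) (rep q x (Finsupp.single (k, 0) 1))
    rw [star_star, form_single_left, map_one, one_mul] at h1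
    rw [h1, diag_apply, map_mul, Module.End.mul_apply]
  rw [h, form, Finsupp.sum, Finsupp.sum, Complex.ofReal_sum]
  exact Finset.sum_congr rfl fun i _ => by rw [Complex.normSq_eq_conj_mul_self]

open scoped ComplexOrder in
theorem diag_pos (k : ℕ) : IsPos q (diag q k) := by
  intro x
  rw [diag_star_mul]
  exact_mod_cast Finset.sum_nonneg fun i _ => Complex.normSq_nonneg _

theorem diag_one (k : ℕ) : diag q k 1 = 1 := by simp [diag_apply]

theorem normSq_diag_le (k : ℕ) (x : OSUq q) :
    Complex.normSq (diag q k x) ≤ (diag q k (star x * x)).re := by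
  rw [diag_star_mul, Complex.ofReal_re, diag_apply, Finsupp.sum]
  set w := rep q x (Finsupp.single (k, 0) 1)
  by_cases hw : (k, (0 : ℤ)) ∈ w.support
  · exact Finset.single_le_sum (f := fun i => Complex.normSq (w i))
      (fun i _ => Complex.normSq_nonneg _) hw
  · rw [Finsupp.notMem_support_iff.1 hw, map_zero]
    exact Finset.sum_nonneg fun i _ => Complex.normSq_nonneg _

theorem exists_diag_bound (x : OSUq q) : ∃ C : ℝ, ∀ k, ‖diag q k x‖ ≤ C := by
  obtain ⟨C, hC, H⟩ := exists_bound x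
  refine ⟨1 + C, fun k => ?_⟩
  have h1 := H _ (diag_pos q k) 1
  rw [mul_one, star_one, one_mul, diag_one, Complex.one_re, mul_one] at h1
  have h2 := normSq_diag_le q k x
  rw [Complex.normSq_eq_norm_sq] at h2
  nlinarith [norm_nonneg (diag q k x)]

theorem q_sq_lt : q ^ 2 < 1 := by nlinarith [hq.out.1, hq.out.2]

theorem summable_diag (x : OSUq q) :
    Summable fun k => (1 - (q : ℂ) ^ 2) * ((q : ℂ) ^ 2) ^ k * diag q k x := by
  obtain ⟨C, hC⟩ := exists_diag_bound q x
  have hg : Summable fun k : ℕ => ‖1 - (q : ℂ) ^ 2‖ * (q ^ 2) ^ k * C :=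
    ((summable_geometric_of_lt_one (sq_nonneg q) (q_sq_lt q)).mul_left _).mul_right _
  refine Summable.of_norm_bounded hg fun k => ?_
  rw [norm_mul, norm_mul]
  have e : ‖((q : ℂ) ^ 2) ^ k‖ = (q ^ 2) ^ k := by
    rw [norm_pow, norm_pow, Complex.norm_real, Real.norm_eq_abs, sq_abs]
  rw [e]
  exact mul_le_mul_of_nonneg_left (hC k) (by positivity)

/-- The functional `x ↦ (1 - q²) ∑ₖ q^{2k} ⟨εₖ₀, x εₖ₀⟩`. -/
noncomputable def haarAux : OSUq q →ₗ[ℂ] ℂ where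
  toFun x := ∑' k, (1 - (q : ℂ) ^ 2) * ((q : ℂ) ^ 2) ^ k * diag q k x
  map_add' x y := by
    simp only [map_add, mul_add]
    exact (summable_diag q x).tsum_add (summable_diag q y)
  map_smul' t x := by
    simp only [map_smul, smul_eq_mul, RingHom.id_apply]
    rw [← tsum_mul_left]
    congr 1; ext k; ring

theorem haarAux_apply (x : OSUq q) :
    haarAux q x = ∑' k, (1 - (q : ℂ) ^ 2) * ((q : ℂ) ^ 2) ^ k * diag q k x := rfl

theorem one_sub_q_ne (m : ℕ) : 1 - (q : ℂ) ^ (m + 1) ≠ 0 := by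
  have : q ^ (m + 1) < 1 := pow_lt_one₀ hq.out.1.le hq.out.2 (Nat.succ_ne_zero m)
  intro h
  have h' : (1 : ℝ) - q ^ (m + 1) = 0 := by exact_mod_cast h
  linarith

theorem haarAux_one : haarAux q 1 = 1 := by
  have hlt : ‖(q : ℂ) ^ 2‖ < 1 := by
    rw [norm_pow, Complex.norm_real, Real.norm_eq_abs, sq_abs]; exact q_sq_lt q
  simp only [haarAux_apply, diag_one, mul_one]
  rw [tsum_mul_left, tsum_geometric_of_norm_lt_one hlt]
  exact mul_inv_cancel₀ (one_sub_q_ne q 1)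

open scoped ComplexOrder in
theorem haarAux_pos : IsPos q (haarAux q) := by
  intro x
  rw [haarAux_apply]
  refine tsum_nonneg fun k => mul_nonneg (mul_nonneg ?_ ?_) (diag_pos q k x)
  · have : 0 ≤ 1 - q ^ 2 := sub_nonneg.2 (q_sq_lt q).le
    exact_mod_cast this
  · have : 0 ≤ (q ^ 2) ^ k := by positivity
    exact_mod_cast this

theorem rep_bc_pow (j k : ℕ) : rep q ((b q * c q) ^ j) (Finsupp.single (k, 0) 1) =
    Finsupp.single (k, 0) ((-(q : ℂ) ^ (2 * k + 1)) ^ j) := by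
  induction j with
  | zero => simp
  | succ j ih =>
    rw [pow_succ', map_mul, Module.End.mul_apply, ih, map_mul, Module.End.mul_apply]
    simp only [rep, OSUq.lift_b, OSUq.lift_c, shift_single, add_sub_cancel_right]
    congr 1; ring

theorem haarAux_bc_pow (j : ℕ) : haarAux q ((b q * c q) ^ j) * (1 - (q : ℂ) ^ (2 * j + 2)) =
    (1 - (q : ℂ) ^ 2) * (-(q : ℂ)) ^ j := by
  have hlt : ‖(q : ℂ) ^ (2 * j + 2)‖ < 1 := by
    rw [norm_pow, Complex.norm_real, Real.norm_eq_abs, abs_of_pos hq.out.1]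
    exact pow_lt_one₀ hq.out.1.le hq.out.2 (by omega)
  have e : ∀ k : ℕ, (1 - (q : ℂ) ^ 2) * ((q : ℂ) ^ 2) ^ k * diag q k ((b q * c q) ^ j) =
      (1 - (q : ℂ) ^ 2) * (-(q : ℂ)) ^ j * ((q : ℂ) ^ (2 * j + 2)) ^ k := by
    intro k
    rw [diag_apply, rep_bc_pow, Finsupp.single_eq_same]
    ring
  rw [haarAux_apply]
  simp only [e]
  rw [tsum_mul_left, tsum_geometric_of_norm_lt_one hlt, mul_assoc,
    inv_mul_cancel₀ (one_sub_q_ne q (2 * j + 1)), mul_one]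

theorem rep_torus {u v : ℂ} (hu : u ≠ 0) (hv : v ≠ 0) (x : OSUq q) (w : ℕ × ℤ →₀ ℂ) :
    rep q (torus q hu hv x) (shift (fun i => u⁻¹ ^ i.1 * v ^ i.2) id w) =
      shift (fun i => u⁻¹ ^ i.1 * v ^ i.2) id (rep q x w) := by
  induction x using OSUq.induction generalizing w with
  | smul t x hx => simp only [map_smul, LinearMap.smul_apply, hx]
  | one => simp
  | mul x y hx hy => simp only [map_mul, Module.End.mul_apply, hx, hy]
  | add x y hx hy => simp only [map_add, LinearMap.add_apply, hx, hy]
  | ha =>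
    induction w using Finsupp.induction_linear with
    | zero => simp
    | add w w' h h' => simp only [map_add, h, h']
    | single i r =>
      obtain ⟨k, n⟩ := i
      simp only [torus_a, map_smul, LinearMap.smul_apply, rep, OSUq.lift_a, shift_single, id,
        Finsupp.smul_single, smul_eq_mul]
      congr 1
      rcases k with _ | k
      · simp [wt_zero]
      · rw [Nat.add_sub_cancel, pow_succ]; field_simp
  | hd =>
    induction w using Finsupp.induction_linear with
    | zero => simp
    | add w w' h h' => simp only [map_add, h, h']
    | single i r =>
      obtain ⟨k, n⟩ := i
      simp only [torus_d, map_smul, LinearMap.smul_apply, rep, OSUq.lift_d, shift_single, id,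
        Finsupp.smul_single, smul_eq_mul]
      congr 1
      ring
  | hb =>
    induction w using Finsupp.induction_linear with
    | zero => simp
    | add w w' h h' => simp only [map_add, h, h']
    | single i r =>
      obtain ⟨k, n⟩ := i
      simp only [torus_b, map_smul, LinearMap.smul_apply, rep, OSUq.lift_b, shift_single, id,
        Finsupp.smul_single, smul_eq_mul]
      congr 1
      rw [zpow_sub_one₀ hv]; ring
  | hc =>
    induction w using Finsupp.induction_linear with
    | zero => simp
    | add w w' h h' => simp only [map_add, h, h']
    | single i r =>
      obtain ⟨k, n⟩ := i
      simp only [torus_c, map_smul, LinearMap.smul_apply, rep, OSUq.lift_c, shift_single, id,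
        Finsupp.smul_single, smul_eq_mul]
      congr 1
      rw [zpow_add_one₀ hv]; ring

theorem shift_id_apply (t : ℕ × ℤ → ℂ) (w : ℕ × ℤ →₀ ℂ) (i : ℕ × ℤ) :
    shift t id w i = w i * t i := by
  induction w using Finsupp.induction_linear with
  | zero => simp
  | add w w' h h' => simp only [map_add, Finsupp.add_apply, h, h', add_mul]
  | single j r =>
    rw [shift_single, id, Finsupp.single_apply, Finsupp.single_apply]
    split_ifs with h
    · rw [h]
    · rw [zero_mul]

theorem haarAux_torus {u v : ℂ} (hu : u ≠ 0) (hv : v ≠ 0) (x : OSUq q) :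
    haarAux q (torus q hu hv x) = haarAux q x := by
  have e : ∀ k, diag q k (torus q hu hv x) = diag q k x := by
    intro k
    have h := congrArg (fun w => w (k, (0 : ℤ))) (rep_torus q hu hv x (Finsupp.single (k, 0) 1))
    simp only [shift_single, id, shift_id_apply, zpow_zero, mul_one, one_mul] at h
    rw [← mul_one (u⁻¹ ^ k), ← smul_eq_mul, ← Finsupp.smul_single, map_smul, Finsupp.smul_apply,
      smul_eq_mul, smul_eq_mul, mul_one, mul_comm] at h
    exact mul_right_cancel₀ (pow_ne_zero _ (inv_ne_zero hu)) h
  simp only [haarAux_apply, e]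

end

section
variable (q : ℝ) [hq : Fact (0 < q ∧ q < 1)]

theorem b_mul_a : b q * a q = (q : ℂ)⁻¹ • (a q * b q) := by
  rw [(rel q).ab, smul_smul, inv_mul_cancel₀ (q_ne q), one_smul]
theorem c_mul_a : c q * a q = (q : ℂ)⁻¹ • (a q * c q) := by
  rw [(rel q).ac, smul_smul, inv_mul_cancel₀ (q_ne q), one_smul]
theorem a_mul_d : a q * d q = 1 + (q : ℂ) • (b q * c q) := by rw [← (rel q).ad]; abel
theorem d_mul_a : d q * a q = 1 + (q : ℂ)⁻¹ • (b q * c q) := by rw [← (rel q).da]; abel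

theorem mul_pow_comm {x y : OSUq q} {t : ℂ} (h : x * y = t • (y * x)) (n : ℕ) :
    x * y ^ n = t ^ n • (y ^ n * x) := by
  induction n with
  | zero => simp
  | succ n ih =>
    rw [pow_succ, ← mul_assoc, ih, smul_mul_assoc, mul_assoc, h, mul_smul_comm, smul_smul,
      mul_assoc, pow_succ]

theorem pow_mul_comm' {x y : OSUq q} {t : ℂ} (h : x * y = t • (y * x)) (n : ℕ) :
    x ^ n * y = t ^ n • (y * x ^ n) := by
  induction n with
  | zero => simp
  | succ n ih =>
    rw [pow_succ', mul_assoc, ih, mul_smul_comm, ← mul_assoc, h, smul_mul_assoc, smul_smul,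
      mul_assoc, pow_succ]

/-- The monomials `aⁱ bʲ cᵏ` and `dⁱ bʲ cᵏ` span. -/
theorem span_monomials : Submodule.span ℂ
    ({x | ∃ i j k : ℕ, x = a q ^ i * b q ^ j * c q ^ k} ∪
      {x | ∃ i j k : ℕ, x = d q ^ i * b q ^ j * c q ^ k}) = ⊤ := by
  set S := Submodule.span ℂ
    ({x | ∃ i j k : ℕ, x = a q ^ i * b q ^ j * c q ^ k} ∪
      {x | ∃ i j k : ℕ, x = d q ^ i * b q ^ j * c q ^ k}) with hS
  have hA : ∀ i j k : ℕ, a q ^ i * b q ^ j * c q ^ k ∈ S :=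
    fun i j k => Submodule.subset_span (Or.inl ⟨i, j, k, rfl⟩)
  have hD : ∀ i j k : ℕ, d q ^ i * b q ^ j * c q ^ k ∈ S :=
    fun i j k => Submodule.subset_span (Or.inr ⟨i, j, k, rfl⟩)
  have hcb : Commute (c q) (b q) := (rel q).bc.symm
  have of_gen : ∀ x : OSUq q, (∀ i j k : ℕ, x * (a q ^ i * b q ^ j * c q ^ k) ∈ S) →
      (∀ i j k : ℕ, x * (d q ^ i * b q ^ j * c q ^ k) ∈ S) → ∀ y ∈ S, x * y ∈ S := by
    intro x h1 h2 y hy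
    induction hy using Submodule.span_induction with
    | mem y hy =>
      rcases hy with ⟨i, j, k, rfl⟩ | ⟨i, j, k, rfl⟩
      exacts [h1 i j k, h2 i j k]
    | zero => simp
    | add y z _ _ hy hz => rw [mul_add]; exact S.add_mem hy hz
    | smul t y _ hy => rw [mul_smul_comm]; exact S.smul_mem t hy
  have hb : ∀ y ∈ S, b q * y ∈ S := by
    apply of_gen
    · intro i j k
      rw [← mul_assoc, ← mul_assoc, mul_pow_comm q (b_mul_a q) i, smul_mul_assoc, smul_mul_assoc,
        mul_assoc (a q ^ i), ← pow_succ']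
      exact S.smul_mem _ (hA _ _ _)
    · intro i j k
      rw [← mul_assoc, ← mul_assoc, mul_pow_comm q (rel q).bd i, smul_mul_assoc, smul_mul_assoc,
        mul_assoc (d q ^ i), ← pow_succ']
      exact S.smul_mem _ (hD _ _ _)
  have hc : ∀ y ∈ S, c q * y ∈ S := by
    apply of_gen
    · intro i j k
      rw [← mul_assoc, ← mul_assoc, mul_pow_comm q (c_mul_a q) i, smul_mul_assoc, smul_mul_assoc,
        mul_assoc (a q ^ i), (hcb.pow_right j).eq, ← mul_assoc, mul_assoc, ← pow_succ']
      exact S.smul_mem _ (hA _ _ _)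
    · intro i j k
      rw [← mul_assoc, ← mul_assoc, mul_pow_comm q (rel q).cd i, smul_mul_assoc, smul_mul_assoc,
        mul_assoc (d q ^ i), (hcb.pow_right j).eq, ← mul_assoc, mul_assoc, ← pow_succ']
      exact S.smul_mem _ (hD _ _ _)
  have ha : ∀ y ∈ S, a q * y ∈ S := by
    apply of_gen
    · intro i j k
      rw [← mul_assoc, ← mul_assoc, ← pow_succ']
      exact hA _ _ _
    · intro i j k
      rcases i with _ | i
      · simpa [mul_assoc] using hA 1 j k
      · have e : a q * (d q ^ (i + 1) * b q ^ j * c q ^ k) = d q ^ i * b q ^ j * c q ^ k +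
            (q : ℂ) • (b q * (c q * (d q ^ i * b q ^ j * c q ^ k))) := by
          rw [pow_succ', mul_assoc (d q), mul_assoc (d q), ← mul_assoc (a q), a_mul_d, add_mul,
            one_mul, smul_mul_assoc, mul_assoc (b q)]
        rw [e]
        exact S.add_mem (hD _ _ _) (S.smul_mem _ (hb _ (hc _ (hD _ _ _))))
  have hd : ∀ y ∈ S, d q * y ∈ S := by
    apply of_gen
    · intro i j k
      rcases i with _ | i
      · simpa [mul_assoc] using hD 1 j k
      · have e : d q * (a q ^ (i + 1) * b q ^ j * c q ^ k) = a q ^ i * b q ^ j * c q ^ k +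
            (q : ℂ)⁻¹ • (b q * (c q * (a q ^ i * b q ^ j * c q ^ k))) := by
          rw [pow_succ', mul_assoc (a q), mul_assoc (a q), ← mul_assoc (d q), d_mul_a, add_mul,
            one_mul, smul_mul_assoc, mul_assoc (b q)]
        rw [e]
        exact S.add_mem (hA _ _ _) (S.smul_mem _ (hb _ (hc _ (hA _ _ _))))
    · intro i j k
      rw [← mul_assoc, ← mul_assoc, ← pow_succ']
      exact hD _ _ _
  have hall : ∀ x : OSUq q, ∀ y ∈ S, x * y ∈ S := by
    intro x
    induction x using OSUq.induction with
    | smul t x hx => intro y hy; rw [smul_mul_assoc]; exact S.smul_mem t (hx y hy)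
    | one => intro y hy; rwa [one_mul]
    | ha => exact ha
    | hb => exact hb
    | hc => exact hc
    | hd => exact hd
    | mul x x' hx hx' => intro y hy; rw [mul_assoc]; exact hx _ (hx' _ hy)
    | add x x' hx hx' => intro y hy; rw [add_mul]; exact S.add_mem (hx y hy) (hx' y hy)
  rw [eq_top_iff]
  intro x _
  simpa using hall x 1 (by simpa using hA 0 0 0)

/-- Linear maps that agree on the monomials are equal. -/
theorem linearMap_ext {V : Type*} [AddCommGroup V] [Module ℂ V] {f g : OSUq q →ₗ[ℂ] V}
    (hA : ∀ i j k : ℕ, f (a q ^ i * b q ^ j * c q ^ k) = g (a q ^ i * b q ^ j * c q ^ k))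
    (hD : ∀ i j k : ℕ, f (d q ^ i * b q ^ j * c q ^ k) = g (d q ^ i * b q ^ j * c q ^ k)) :
    f = g := by
  apply LinearMap.ext_on (span_monomials q)
  rintro x (⟨i, j, k, rfl⟩ | ⟨i, j, k, rfl⟩)
  exacts [hA i j k, hD i j k]

/-- The coefficients `∑_{i < k} q^{-2i}`. -/
noncomputable def geom (k : ℕ) : ℂ := ∑ i ∈ Finset.range k, ((q : ℂ)⁻¹ ^ 2) ^ i

theorem geom_succ (k : ℕ) : geom q (k + 1) = geom q k + ((q : ℂ)⁻¹ ^ 2) ^ k := by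
  rw [geom, Finset.sum_range_succ, geom]

theorem geom_ne (k : ℕ) : geom q (k + 1) ≠ 0 := by
  have h : 0 < ∑ i ∈ Finset.range (k + 1), (q⁻¹ ^ 2) ^ i :=
    Finset.sum_pos (fun i _ => by have := hq.out.1; positivity) ⟨0, by simp⟩
  have e : geom q (k + 1) = ((∑ i ∈ Finset.range (k + 1), (q⁻¹ ^ 2) ^ i : ℝ) : ℂ) := by
    rw [geom]; push_cast; rfl
  rw [e]
  exact_mod_cast h.ne'

theorem bc_mul_a : b q * c q * a q = ((q : ℂ)⁻¹ ^ 2) • (a q * (b q * c q)) := by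
  rw [mul_assoc, c_mul_a, mul_smul_comm, ← mul_assoc, b_mul_a, smul_mul_assoc, smul_smul,
    mul_assoc, pow_two]

theorem actK_bc : actK q (b q * c q) = b q * c q := by
  rw [map_mul, actK_b, actK_c, smul_mul_assoc, mul_smul_comm, smul_smul,
    inv_mul_cancel₀ (qHalf_ne q), one_smul]
theorem actKinv_bc : actKinv q (b q * c q) = b q * c q := by
  rw [map_mul, actKinv_b, actKinv_c, smul_mul_assoc, mul_smul_comm, smul_smul,
    mul_inv_cancel₀ (qHalf_ne q), one_smul]
theorem actE_bc : actE q (b q * c q) = (qHalf q)⁻¹ • (a q * c q) := by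
  rw [actE_mul, actE_b, actE_c, actKinv_c, mul_zero, add_zero, mul_smul_comm]

theorem actE_dbc (k : ℕ) : actE q (d q * b q * (b q * c q) ^ k) =
    (qHalf q)⁻¹ • (geom q (k + 1) • (b q * c q) ^ k +
      ((q : ℂ) * geom q (k + 2)) • (b q * c q) ^ (k + 1)) := by
  have hqne := q_ne q
  have hs := qHalf_ne q
  have hcb : Commute (c q) (b q) := (rel q).bc.symm
  have hdbk : ∀ k : ℕ, actK q (d q * b q * (b q * c q) ^ k) =
      (q : ℂ)⁻¹ • (d q * b q * (b q * c q) ^ k) := by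
    intro k
    rw [map_mul, map_pow, actK_bc, map_mul, actK_d, actK_b, smul_mul_assoc, mul_smul_comm,
      smul_smul, smul_mul_assoc, qHalf_mul q, mul_inv]
  induction k with
  | zero =>
    have hg1 : geom q 1 = 1 := by simp [geom]
    have hg2 : geom q 2 = 1 + (q : ℂ)⁻¹ ^ 2 := by simp [geom, Finset.sum_range_succ]
    simp only [pow_zero, mul_one, actE_mul, actE_d, actE_b, actKinv_b, actK_d, smul_mul_assoc,
      d_mul_a, mul_smul_comm, hcb.eq, zero_add, hg1, hg2, pow_one]
    have : qHalf q = (qHalf q)⁻¹ * q := by rw [qHalf_mul q]; field_simp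
    nth_rewrite 1 [this]
    match_scalars <;> field_simp
  | succ k ih =>
    have e : d q * b q * (b q * c q) ^ k * (a q * c q) =
        ((q : ℂ)⁻¹ ^ 2) ^ k • (q : ℂ)⁻¹ •
          ((b q * c q) ^ (k + 1) + (q : ℂ)⁻¹ • (b q * c q) ^ (k + 2)) := by
      calc d q * b q * (b q * c q) ^ k * (a q * c q)
          = d q * b q * ((b q * c q) ^ k * a q) * c q := by simp only [mul_assoc]
        _ = ((q : ℂ)⁻¹ ^ 2) ^ k • (d q * (b q * a q) * ((b q * c q) ^ k * c q)) := by
            rw [pow_mul_comm' q (bc_mul_a q)]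
            simp only [mul_smul_comm, smul_mul_assoc, mul_assoc]
        _ = ((q : ℂ)⁻¹ ^ 2) ^ k • (q : ℂ)⁻¹ • ((d q * a q) * (b q * ((b q * c q) ^ k * c q))) := by
            rw [b_mul_a]; simp only [mul_smul_comm, smul_mul_assoc, mul_assoc]
        _ = ((q : ℂ)⁻¹ ^ 2) ^ k • (q : ℂ)⁻¹ • ((d q * a q) * (b q * c q) ^ (k + 1)) := by
            have hcz : Commute (c q) (b q * c q) := hcb.mul_right (Commute.refl _)
            rw [← (hcz.pow_right k).eq, ← mul_assoc (b q), ← pow_succ']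
        _ = _ := by
            rw [d_mul_a, add_mul, one_mul, smul_mul_assoc, ← pow_succ']
    have g1 : geom q (k + 2) = geom q (k + 1) + ((q : ℂ)⁻¹ ^ 2) ^ k * (q : ℂ)⁻¹ ^ 2 := by
      rw [← pow_succ]; exact geom_succ q (k + 1)
    have g3 : geom q (k + 1 + 2) = geom q (k + 1) + ((q : ℂ)⁻¹ ^ 2) ^ k * (q : ℂ)⁻¹ ^ 2 +
        ((q : ℂ)⁻¹ ^ 2) ^ k * (q : ℂ)⁻¹ ^ 2 * (q : ℂ)⁻¹ ^ 2 := by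
      rw [← g1, ← pow_succ, ← pow_succ]; exact geom_succ q (k + 2)
    rw [pow_succ, ← mul_assoc, actE_mul, ih, actKinv_bc, actE_bc, hdbk]
    simp only [smul_mul_assoc, mul_smul_comm, e, add_mul, ← pow_succ]
    simp only [g1, g3]
    generalize ((q : ℂ)⁻¹ ^ 2) ^ k = t
    match_scalars <;> field_simp

theorem haarAux_actE_dbc (k : ℕ) : haarAux q (actE q (d q * b q * (b q * c q) ^ k)) = 0 := by
  have hqne := q_ne q
  have h1 := haarAux_bc_pow q k
  have h2 := haarAux_bc_pow q (k + 1)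
  have n1 : 1 - (q : ℂ) ^ (2 * k + 2) ≠ 0 := one_sub_q_ne q (2 * k + 1)
  have n2 : 1 - (q : ℂ) ^ (2 * (k + 1) + 2) ≠ 0 := one_sub_q_ne q (2 * (k + 1) + 1)
  have g : ∀ m : ℕ, geom q m * (q : ℂ) ^ (2 * m) * (1 - (q : ℂ) ^ 2) =
      (q : ℂ) ^ 2 * (1 - (q : ℂ) ^ (2 * m)) := by
    intro m
    induction m with
    | zero => simp [geom]
    | succ m ih =>
      rw [geom_succ]
      have e : ((q : ℂ)⁻¹ ^ 2) ^ m * (q : ℂ) ^ (2 * (m + 1)) = (q : ℂ) ^ 2 := by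
        rw [← pow_mul, inv_pow, mul_add, pow_add]; field_simp
      have e2 : (q : ℂ) ^ (2 * (m + 1)) = (q : ℂ) ^ (2 * m) * (q : ℂ) ^ 2 := by ring
      calc _ = (geom q m * (q : ℂ) ^ (2 * m) * (1 - (q : ℂ) ^ 2)) * (q : ℂ) ^ 2 +
            (((q : ℂ)⁻¹ ^ 2) ^ m * (q : ℂ) ^ (2 * (m + 1))) * (1 - (q : ℂ) ^ 2) := by
              rw [e2]; ring
        _ = _ := by rw [ih, e, e2]; ring
  have g1 := g (k + 1)
  have g2 := g (k + 2)
  have n0 : 1 - (q : ℂ) ^ 2 ≠ 0 := one_sub_q_ne q 1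
  rw [actE_dbc, map_smul, map_add, map_smul, map_smul]
  have h3 : haarAux q ((b q * c q) ^ (k + 1)) * (1 - (q : ℂ) ^ (2 * (k + 1) + 2)) =
      -(q : ℂ) * (haarAux q ((b q * c q) ^ k) * (1 - (q : ℂ) ^ (2 * k + 2))) := by
    rw [h1, h2]; ring
  set A := haarAux q ((b q * c q) ^ k)
  set B := haarAux q ((b q * c q) ^ (k + 1))
  have key : geom q (k + 1) * A + q * geom q (k + 2) * B = 0 := by
    have hp : (q : ℂ) ^ (2 * (k + 2)) * (1 - (q : ℂ) ^ 2) ≠ 0 :=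
      mul_ne_zero (pow_ne_zero _ hqne) n0
    apply mul_right_cancel₀ hp
    have e1 : (q : ℂ) ^ (2 * (k + 2)) = (q : ℂ) ^ (2 * (k + 1)) * (q : ℂ) ^ 2 := by ring
    calc _ = (geom q (k + 1) * (q : ℂ) ^ (2 * (k + 1)) * (1 - (q : ℂ) ^ 2)) * (q : ℂ) ^ 2 * A +
          q * (geom q (k + 2) * (q : ℂ) ^ (2 * (k + 2)) * (1 - (q : ℂ) ^ 2)) * B := by
            rw [e1]; ring
      _ = 0 * ((q : ℂ) ^ (2 * (k + 2)) * (1 - (q : ℂ) ^ 2)) := by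
            rw [g1, g2]
            linear_combination (q : ℂ) ^ 3 * h3
  simp only [smul_eq_mul, key, mul_zero]

end

section
variable (q : ℝ) [hq : Fact (0 < q ∧ q < 1)]

theorem zpow_eq_one {r : ℝ} (hr : 0 < r) (hr1 : r ≠ 1) {n : ℤ} (h : (r : ℂ) ^ n = 1) : n = 0 := by
  have h' : r ^ n = 1 := by exact_mod_cast h
  exact (zpow_eq_one_iff_right₀ hr.le hr1).1 h'

theorem qHalf_zpow {n : ℤ} (h : qHalf q ^ n = 1) : n = 0 := by
  refine zpow_eq_one (Real.sqrt_pos.2 hq.out.1) ?_ h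
  rw [Ne, Real.sqrt_eq_one]
  exact hq.out.2.ne

theorem actE_a_pow (n : ℕ) : actE q (a q ^ n) = 0 := by
  induction n with
  | zero => simp
  | succ n ih => rw [pow_succ, actE_mul, ih, actE_a, zero_mul, mul_zero, add_zero]
theorem actE_c_pow (n : ℕ) : actE q (c q ^ n) = 0 := by
  induction n with
  | zero => simp
  | succ n ih => rw [pow_succ, actE_mul, ih, actE_c, zero_mul, mul_zero, add_zero]
theorem actF_b_pow (n : ℕ) : actF q (b q ^ n) = 0 := by
  induction n with
  | zero => simp
  | succ n ih => rw [pow_succ, actF_mul, ih, actF_b, zero_mul, mul_zero, add_zero]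
theorem actF_d_pow (n : ℕ) : actF q (d q ^ n) = 0 := by
  induction n with
  | zero => simp
  | succ n ih => rw [pow_succ, actF_mul, ih, actF_d, zero_mul, mul_zero, add_zero]

theorem actE_b_pow (n : ℕ) : ∃ C : ℝ, 0 < C ∧ actE q (b q ^ (n + 1)) = (C : ℂ) • (a q * b q ^ n) := by
  have h0 := hq.out.1
  have hs : 0 < √q := Real.sqrt_pos.2 h0
  induction n with
  | zero => exact ⟨1, one_pos, by simp⟩
  | succ n ih =>
    obtain ⟨C, hC, h⟩ := ih
    refine ⟨√q * C + (√q)⁻¹ ^ (n + 1) * q⁻¹ ^ (n + 1), by positivity, ?_⟩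
    rw [pow_succ, actE_mul, h, actE_b, actKinv_b, map_pow, actK_b, smul_pow, smul_mul_assoc,
      smul_mul_assoc, mul_smul_comm, mul_assoc, ← pow_succ, pow_mul_comm' q (b_mul_a q), smul_smul,
      smul_smul, ← add_smul]
    congr 1
    rw [qHalf]; push_cast; ring

theorem actF_c_pow (n : ℕ) : ∃ C : ℝ, 0 < C ∧ actF q (c q ^ (n + 1)) = (C : ℂ) • (d q * c q ^ n) := by
  have h0 := hq.out.1
  have hs : 0 < √q := Real.sqrt_pos.2 h0
  induction n with
  | zero => exact ⟨1, one_pos, by simp⟩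
  | succ n ih =>
    obtain ⟨C, hC, h⟩ := ih
    refine ⟨(√q)⁻¹ * C + √q ^ (n + 1) * q ^ (n + 1), by positivity, ?_⟩
    rw [pow_succ, actF_mul, h, actF_c, actKinv_c, map_pow, actK_c, smul_pow, smul_mul_assoc,
      smul_mul_assoc, mul_smul_comm, mul_assoc, ← pow_succ, pow_mul_comm' q (rel q).cd, smul_smul,
      smul_smul, ← add_smul]
    congr 1
    rw [qHalf]; push_cast; ring

theorem bc_pow (k : ℕ) : (b q * c q) ^ k = b q ^ k * c q ^ k :=
  (show Commute (b q) (c q) from (rel q).bc).mul_pow k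

section unique
variable {V : Type*} [AddCommGroup V] [Module ℂ V] {ψ : OSUq q →ₗ[ℂ] V}

theorem invariant_a (he : ∀ x, ψ (actE q x) = 0) (i j k : ℕ) :
    ψ (a q ^ (i + 1) * b q ^ j * c q ^ k) = 0 := by
  obtain ⟨C, hC, h⟩ := actE_b_pow q j
  have h1 := he (a q ^ i * b q ^ (j + 1) * c q ^ k)
  rw [actE_mul, actE_mul, actE_a_pow, actE_c_pow, h, zero_mul, zero_add, mul_zero, add_zero, map_pow,
    map_pow, actK_a, actKinv_c, smul_pow, smul_pow, smul_mul_assoc, smul_mul_assoc, mul_smul_comm,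
    mul_smul_comm, smul_mul_assoc, ← mul_assoc, ← pow_succ, map_smul, map_smul, map_smul] at h1
  have n1 : (C : ℂ) ≠ 0 := by exact_mod_cast hC.ne'
  have n2 := pow_ne_zero i (qHalf_ne q)
  have n3 := pow_ne_zero k (inv_ne_zero (qHalf_ne q))
  simpa only [smul_eq_zero, n1, n2, n3, false_or] using h1

theorem invariant_d (hf : ∀ x, ψ (actF q x) = 0) (i j k : ℕ) :
    ψ (d q ^ (i + 1) * b q ^ j * c q ^ k) = 0 := by
  obtain ⟨C, hC, h⟩ := actF_c_pow q k
  have h1 := hf (d q ^ i * b q ^ j * c q ^ (k + 1))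
  rw [actF_mul, actF_mul, actF_d_pow, actF_b_pow, h, zero_mul, zero_add, mul_zero, zero_mul, zero_add,
    map_mul (actK q), map_pow, map_pow, actK_d, actK_b, smul_pow, smul_pow, smul_mul_assoc,
    smul_mul_assoc, mul_smul_comm, mul_smul_comm, smul_mul_assoc, ← mul_assoc, mul_assoc (d q ^ i),
    pow_mul_comm' q (rel q).bd, mul_smul_comm, smul_mul_assoc, ← mul_assoc, ← pow_succ,
    map_smul, map_smul, map_smul, map_smul] at h1
  have n1 : (C : ℂ) ≠ 0 := by exact_mod_cast hC.ne'
  have n2 := pow_ne_zero i (inv_ne_zero (qHalf_ne q))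
  have n3 := pow_ne_zero j (inv_ne_zero (qHalf_ne q))
  have n4 := pow_ne_zero j (q_ne q)
  simpa only [smul_eq_zero, n1, n2, n3, n4, false_or] using h1

theorem invariant_bc (hk : ∀ x, ψ (actK q x) = ψ x) {j k : ℕ} (hjk : j ≠ k) :
    ψ (b q ^ j * c q ^ k) = 0 := by
  have h1 := hk (b q ^ j * c q ^ k)
  rw [map_mul, map_pow, map_pow, actK_b, actK_c, smul_pow, smul_pow, smul_mul_assoc, mul_smul_comm,
    smul_smul, map_smul] at h1
  have e : (qHalf q)⁻¹ ^ j * qHalf q ^ k = qHalf q ^ ((k : ℤ) - j) := by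
    rw [zpow_sub₀ (qHalf_ne q), zpow_natCast, zpow_natCast, inv_pow, div_eq_mul_inv, mul_comm]
  rw [e, ← sub_eq_zero] at h1
  have h2 : (qHalf q ^ ((k : ℤ) - j) - 1) • ψ (b q ^ j * c q ^ k) = 0 := by
    rw [sub_smul, one_smul, h1]
  rcases smul_eq_zero.1 h2 with h | h
  · have := qHalf_zpow q (sub_eq_zero.1 h)
    omega
  · exact h

end unique

section
variable {q}
theorem torus_actK {u v : ℂ} (hu : u ≠ 0) (hv : v ≠ 0) (x : OSUq q) :
    torus q hu hv (actK q x) = actK q (torus q hu hv x) := by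
  have : (torus q hu hv).comp (actK q) = (actK q).comp (torus q hu hv) := by
    apply OSUq.algHom_ext <;> simp [smul_smul, mul_comm]
  exact congrArg (fun f : OSUq q →ₐ[ℂ] OSUq q => f x) this

theorem torus_actKinv {u v : ℂ} (hu : u ≠ 0) (hv : v ≠ 0) (x : OSUq q) :
    torus q hu hv (actKinv q x) = actKinv q (torus q hu hv x) := by
  have : (torus q hu hv).comp (actKinv q) = (actKinv q).comp (torus q hu hv) := by
    apply OSUq.algHom_ext <;> simp [smul_smul, mul_comm]
  exact congrArg (fun f : OSUq q →ₐ[ℂ] OSUq q => f x) this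

theorem torus_actE {u v : ℂ} (hu : u ≠ 0) (hv : v ≠ 0) (x : OSUq q) :
    torus q hu hv (actE q x) = (u * v) • actE q (torus q hu hv x) := by
  induction x using OSUq.induction with
  | smul t x hx => simp only [map_smul, hx, smul_comm t]
  | one => simp
  | ha => simp
  | hb => simp [smul_smul, hv]
  | hc => simp
  | hd => simp only [actE_d, torus_c, torus_d, map_smul, smul_smul]; congr 1; field_simp
  | mul x y hx hy =>
    simp only [actE_mul, map_add, map_mul, hx, hy, torus_actK, torus_actKinv, smul_mul_assoc,
      mul_smul_comm, smul_add]
  | add x y hx hy => simp only [map_add, hx, hy, smul_add]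
end

theorem haarAux_actE (x : OSUq q) : haarAux q (actE q x) = 0 := by
  have h2 : (2 : ℂ) ≠ 0 := two_ne_zero
  have h1 : (1 : ℂ) ≠ 0 := one_ne_zero
  have hz : ∀ {n : ℤ}, (2 : ℂ) ^ n = 1 → n = 0 := by
    intro n h
    exact zpow_eq_one (r := 2) two_pos (by norm_num) (by push_cast; exact h)
  have key : ∀ (t : ℂ) (m : OSUq q) {u v : ℂ} (hu : u ≠ 0) (hv : v ≠ 0),
      torus q hu hv m = t • m → u * v * t ≠ 1 → haarAux q (actE q m) = 0 := by
    intro t m u v hu hv hm ht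
    have h := haarAux_torus q hu hv (actE q m)
    rw [torus_actE, hm] at h
    simp only [map_smul, smul_smul] at h
    rw [smul_eq_mul] at h
    by_contra hne
    exact ht (mul_right_cancel₀ hne (by rw [h, one_mul]))
  suffices haarAux q ∘ₗ actE q = 0 from congrArg (fun f : OSUq q →ₗ[ℂ] ℂ => f x) this
  apply linearMap_ext q
  · intro i j k
    refine key (2 ^ i) _ h2 h1 ?_ ?_
    · simp only [map_mul, map_pow, torus_a, torus_b, torus_c, inv_one, one_smul, smul_pow,
        smul_mul_assoc]
    · intro h
      have : ((i : ℤ) + 1) = 0 := hz (by rw [zpow_add₀ h2, zpow_natCast, zpow_one, ← h]; ring)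
      omega
  · intro i j k
    by_cases hi : i = 1
    · by_cases hj : j = k + 1
      · subst hi hj
        have e : d q ^ 1 * b q ^ (k + 1) * c q ^ k = d q * b q * (b q * c q) ^ k := by
          rw [bc_pow, pow_one, pow_succ']; simp only [mul_assoc]
        rw [e]
        exact haarAux_actE_dbc q k
      · refine key (2⁻¹ ^ j * 2 ^ k) _ h1 h2 ?_ ?_
        · simp only [map_mul, map_pow, torus_d, torus_b, torus_c, inv_one, one_smul, smul_pow,
            smul_mul_assoc, mul_smul_comm, smul_smul]
          rw [mul_comm]
        · intro h
          have : (k : ℤ) + 1 - j = 0 := hz (by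
            rw [zpow_sub₀ h2, zpow_add₀ h2, zpow_natCast, zpow_natCast, zpow_one, ← h, inv_pow]
            ring)
          omega
    · refine key (2⁻¹ ^ i) _ h2 h1 ?_ ?_
      · simp only [map_mul, map_pow, torus_d, torus_b, torus_c, inv_one, one_smul, smul_pow,
          smul_mul_assoc]
      · intro h
        have : (1 : ℤ) - i = 0 := hz (by
          rw [zpow_sub₀ h2, zpow_natCast, zpow_one, ← h, inv_pow]; ring)
        omega

theorem actK_star (x : OSUq q) : actK q (star x) = star (actKinv q x) := by
  have hcs : conj (qHalf q) = qHalf q := by simp [qHalf]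
  induction x using OSUq.induction with
  | smul t x hx => simp only [map_smul, star_smul, hx]
  | one => simp
  | ha => simp [star_a, star_smul, hcs]
  | hb => simp [star_b, star_smul, hcs, smul_smul, mul_comm, -Complex.coe_smul]
  | hc => simp [star_c, star_smul, hcs, smul_smul, mul_comm, -Complex.coe_smul]
  | hd => simp [star_d, star_smul, hcs]
  | mul x y hx hy => simp only [star_mul, map_mul, hx, hy]
  | add x y hx hy => simp only [star_add, map_add, hx, hy]

theorem actKinv_star (x : OSUq q) : actKinv q (star x) = star (actK q x) := by
  have h := actK_star q (actK q x)
  rw [actKinv_actK] at h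
  rw [← h, actKinv_actK]

theorem actF_star (x : OSUq q) : actF q (star x) = -(q : ℂ) • star (actE q x) := by
  have hqne := q_ne q
  induction x using OSUq.induction with
  | smul t x hx => simp only [map_smul, star_smul, hx, smul_comm (star t)]
  | one => simp
  | ha => simp [star_a]
  | hb => simp [star_b, star_a]
  | hc => simp [star_c]
  | hd => rw [star_d, actF_a, actE_d, star_c, smul_smul, neg_mul_neg, mul_inv_cancel₀ hqne, one_smul]
  | mul x y hx hy =>
    simp only [star_mul, actF_mul, actE_mul, star_add, hx, hy, actK_star, actKinv_star, smul_add,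
      smul_mul_assoc, mul_smul_comm]
    rw [add_comm]
  | add x y hx hy => simp only [star_add, map_add, hx, hy, smul_add]

theorem haarAux_actF (x : OSUq q) : haarAux q (actF q x) = 0 := by
  rw [← star_star x, actF_star, map_smul, (haarAux_pos q).map_star, haarAux_actE, map_zero, smul_zero]

theorem haarAux_actK (x : OSUq q) : haarAux q (actK q x) = haarAux q x := haarAux_torus q _ _ x

/-- Uniqueness of linear maps invariant under the left action. -/
theorem invariant_unique {V : Type*} [AddCommGroup V] [Module ℂ V] {ψ : OSUq q →ₗ[ℂ] V}
    (hk : ∀ x, ψ (actK q x) = ψ x) (he : ∀ x, ψ (actE q x) = 0) (hf : ∀ x, ψ (actF q x) = 0)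
    (x : OSUq q) : ψ x = haarAux q x • ψ 1 := by
  have hz : ∀ k : ℕ, ψ ((b q * c q) ^ k) = haarAux q ((b q * c q) ^ k) • ψ 1 := by
    intro k
    induction k with
    | zero => rw [pow_zero, haarAux_one, one_smul]
    | succ k ih =>
      have h1 := he (d q * b q * (b q * c q) ^ k)
      have h2 := haarAux_actE q (d q * b q * (b q * c q) ^ k)
      rw [actE_dbc, map_smul, smul_eq_zero_iff_right (inv_ne_zero (qHalf_ne q)), map_add, map_smul,
        map_smul] at h1 h2
      have hn : (q : ℂ) * geom q (k + 2) ≠ 0 := mul_ne_zero (q_ne q) (geom_ne q (k + 1))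
      refine smul_right_injective V hn ?_
      simp only
      rw [eq_neg_of_add_eq_zero_right h1, ih, smul_smul, smul_smul, ← smul_eq_mul (_ * _) (haarAux q _),
        eq_neg_of_add_eq_zero_right h2, neg_smul, smul_eq_mul]
  have h0 : ∀ j k : ℕ, ψ (b q ^ j * c q ^ k) = haarAux q (b q ^ j * c q ^ k) • ψ 1 := by
    intro j k
    by_cases hjk : j = k
    · rw [hjk, ← bc_pow, hz]
    · rw [invariant_bc q hk hjk, invariant_bc q (haarAux_actK q) hjk, zero_smul]
  suffices ψ = (LinearMap.toSpanSingleton ℂ V (ψ 1)) ∘ₗ haarAux q from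
    congrArg (fun f : OSUq q →ₗ[ℂ] V => f x) this
  apply linearMap_ext q
  · intro i j k
    rw [LinearMap.comp_apply, LinearMap.toSpanSingleton_apply]
    rcases i with _ | i
    · rw [pow_zero, one_mul, h0]
    · rw [invariant_a q he, invariant_a q (haarAux_actE q), zero_smul]
  · intro i j k
    rw [LinearMap.comp_apply, LinearMap.toSpanSingleton_apply]
    rcases i with _ | i
    · rw [pow_zero, one_mul, h0]
    · rw [invariant_d q hf, invariant_d q (haarAux_actF q), zero_smul]

theorem coproduct_actK (x : OSUq q) : coproduct q (actK q x) =
    (actK q).toLinearMap.lTensor (OSUq q) (coproduct q x) := by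
  have h : (coproduct q).comp (actK q) =
      (Algebra.TensorProduct.map (AlgHom.id ℂ (OSUq q)) (actK q)).comp (coproduct q) := by
    apply OSUq.algHom_ext <;> simp [coproduct, TensorProduct.tmul_smul, smul_add]
  exact congrArg (fun f : OSUq q →ₐ[ℂ] OSUq q ⊗[ℂ] OSUq q => f x) h

theorem coproduct_actKinv (x : OSUq q) : coproduct q (actKinv q x) =
    (actKinv q).toLinearMap.lTensor (OSUq q) (coproduct q x) := by
  have h : (coproduct q).comp (actKinv q) =
      (Algebra.TensorProduct.map (AlgHom.id ℂ (OSUq q)) (actKinv q)).comp (coproduct q) := by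
    apply OSUq.algHom_ext <;> simp [coproduct, TensorProduct.tmul_smul, smul_add]
  exact congrArg (fun f : OSUq q →ₐ[ℂ] OSUq q ⊗[ℂ] OSUq q => f x) h

theorem lTensor_actE_mul (x y : OSUq q ⊗[ℂ] OSUq q) : (actE q).lTensor (OSUq q) (x * y) =
    (actE q).lTensor (OSUq q) x * (actKinv q).toLinearMap.lTensor (OSUq q) y +
      (actK q).toLinearMap.lTensor (OSUq q) x * (actE q).lTensor (OSUq q) y := by
  induction x using TensorProduct.induction_on with
  | zero => simp
  | add x x' hx hx' => simp only [add_mul, map_add, hx, hx']; abel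
  | tmul u v =>
    induction y using TensorProduct.induction_on with
    | zero => simp
    | add y y' hy hy' => simp only [mul_add, map_add, hy, hy']; abel
    | tmul u' v' => simp [actE_mul, TensorProduct.tmul_add]

theorem lTensor_actF_mul (x y : OSUq q ⊗[ℂ] OSUq q) : (actF q).lTensor (OSUq q) (x * y) =
    (actF q).lTensor (OSUq q) x * (actKinv q).toLinearMap.lTensor (OSUq q) y +
      (actK q).toLinearMap.lTensor (OSUq q) x * (actF q).lTensor (OSUq q) y := by
  induction x using TensorProduct.induction_on with
  | zero => simp
  | add x x' hx hx' => simp only [add_mul, map_add, hx, hx']; abel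
  | tmul u v =>
    induction y using TensorProduct.induction_on with
    | zero => simp
    | add y y' hy hy' => simp only [mul_add, map_add, hy, hy']; abel
    | tmul u' v' => simp [actF_mul, TensorProduct.tmul_add]

theorem coproduct_actE (x : OSUq q) : coproduct q (actE q x) =
    (actE q).lTensor (OSUq q) (coproduct q x) := by
  induction x using OSUq.induction with
  | smul t x hx => simp only [map_smul, hx]
  | one => simp [Algebra.TensorProduct.one_def]
  | ha => simp [coproduct]
  | hb => simp [coproduct]
  | hc => simp [coproduct]
  | hd => simp [coproduct]
  | mul x y hx hy => simp only [actE_mul, map_add, map_mul, hx, hy, coproduct_actK,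
      coproduct_actKinv, lTensor_actE_mul]
  | add x y hx hy => simp only [map_add, hx, hy]

theorem coproduct_actF (x : OSUq q) : coproduct q (actF q x) =
    (actF q).lTensor (OSUq q) (coproduct q x) := by
  induction x using OSUq.induction with
  | smul t x hx => simp only [map_smul, hx]
  | one => simp [Algebra.TensorProduct.one_def]
  | ha => simp [coproduct]
  | hb => simp [coproduct]
  | hc => simp [coproduct]
  | hd => simp [coproduct]
  | mul x y hx hy => simp only [actF_mul, map_add, map_mul, hx, hy, coproduct_actK,
      coproduct_actKinv, lTensor_actF_mul]
  | add x y hx hy => simp only [map_add, hx, hy]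

theorem haarAux_id_conv (x : OSUq q) :
    TensorProduct.rid ℂ (OSUq q) ((haarAux q).lTensor (OSUq q) (coproduct q x)) =
      haarAux q x • 1 := by
  let ψ : OSUq q →ₗ[ℂ] OSUq q := (TensorProduct.rid ℂ (OSUq q)).toLinearMap ∘ₗ
    (haarAux q).lTensor (OSUq q) ∘ₗ (coproduct q).toLinearMap
  have hψ : ∀ y, ψ y = TensorProduct.rid ℂ (OSUq q)
    ((haarAux q).lTensor (OSUq q) (coproduct q y)) := fun y => rfl
  have e1 : haarAux q ∘ₗ (actK q).toLinearMap = haarAux q := LinearMap.ext (haarAux_actK q)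
  have e2 : haarAux q ∘ₗ actE q = 0 := LinearMap.ext (haarAux_actE q)
  have e3 : haarAux q ∘ₗ actF q = 0 := LinearMap.ext (haarAux_actF q)
  have h := invariant_unique q (ψ := ψ)
    (fun y => by rw [hψ, hψ, coproduct_actK, ← LinearMap.lTensor_comp_apply, e1])
    (fun y => by rw [hψ, coproduct_actE, ← LinearMap.lTensor_comp_apply, e2]; simp)
    (fun y => by rw [hψ, coproduct_actF, ← LinearMap.lTensor_comp_apply, e3]; simp) x
  rw [hψ, hψ] at h
  rw [h]
  simp [Algebra.TensorProduct.one_def, haarAux_one]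

theorem transpose_relations : Relations q (a q) (c q) (b q) (d q) := by
  obtain ⟨hab, hac, hbd, hcd, hbc, had, hda⟩ := rel q
  exact ⟨hac, hab, hcd, hbd, hbc.symm, hbc ▸ had, hbc ▸ hda⟩

/-- The algebra endomorphism exchanging `b` and `c`. -/
noncomputable def transpose : OSUq q →ₐ[ℂ] OSUq q := OSUq.lift (transpose_relations q)

theorem transpose_transpose (x : OSUq q) : transpose q (transpose q x) = x := by
  have : (transpose q).comp (transpose q) = AlgHom.id ℂ _ := by
    apply OSUq.algHom_ext <;> simp [transpose]
  exact congrArg (fun f : OSUq q →ₐ[ℂ] OSUq q => f x) this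

theorem coproduct_transpose (x : OSUq q) : coproduct q (transpose q x) =
    TensorProduct.comm ℂ _ _ (TensorProduct.map (transpose q).toLinearMap (transpose q).toLinearMap
      (coproduct q x)) := by
  have h : (coproduct q).comp (transpose q) =
      (Algebra.TensorProduct.comm ℂ (OSUq q) (OSUq q)).toAlgHom.comp
        ((Algebra.TensorProduct.map (transpose q) (transpose q)).comp (coproduct q)) := by
    apply OSUq.algHom_ext <;> simp [coproduct, transpose]
  exact congrArg (fun f : OSUq q →ₐ[ℂ] OSUq q ⊗[ℂ] OSUq q => f x) h

theorem haarAux_transpose (x : OSUq q) : haarAux q (transpose q x) = haarAux q x := by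
  suffices haarAux q ∘ₗ (transpose q).toLinearMap = haarAux q from
    congrArg (fun f : OSUq q →ₗ[ℂ] ℂ => f x) this
  have hcomm : ∀ j k : ℕ, c q ^ j * b q ^ k = b q ^ k * c q ^ j := fun j k =>
    ((show Commute (c q) (b q) from (rel q).bc.symm).pow_pow j k).eq
  have hk := haarAux_actK q
  have he := haarAux_actE q
  have hf := haarAux_actF q
  apply linearMap_ext q <;> intro i j k <;>
    simp only [LinearMap.comp_apply, AlgHom.toLinearMap_apply, map_mul, map_pow, transpose,
      OSUq.lift_a, OSUq.lift_b, OSUq.lift_c, OSUq.lift_d, mul_assoc, hcomm] <;>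
    simp only [← mul_assoc]
  · rcases i with _ | i
    · simp only [pow_zero, one_mul]
      by_cases hjk : j = k
      · rw [hjk]
      · rw [invariant_bc q hk hjk, invariant_bc q hk (Ne.symm hjk)]
    · rw [invariant_a q he, invariant_a q he]
  · rcases i with _ | i
    · simp only [pow_zero, one_mul]
      by_cases hjk : j = k
      · rw [hjk]
      · rw [invariant_bc q hk hjk, invariant_bc q hk (Ne.symm hjk)]
    · rw [invariant_d q hf, invariant_d q hf]

theorem haarAux_conv_id (x : OSUq q) :
    TensorProduct.lid ℂ (OSUq q) ((haarAux q).rTensor (OSUq q) (coproduct q x)) =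
      haarAux q x • 1 := by
  have key : ∀ t : OSUq q ⊗[ℂ] OSUq q, TensorProduct.lid ℂ (OSUq q) ((haarAux q).rTensor (OSUq q)
      (TensorProduct.comm ℂ _ _ (TensorProduct.map (transpose q).toLinearMap
        (transpose q).toLinearMap t))) =
      transpose q (TensorProduct.rid ℂ (OSUq q) ((haarAux q).lTensor (OSUq q) t)) := by
    intro t
    induction t using TensorProduct.induction_on with
    | zero => simp
    | add t t' ht ht' => simp only [map_add, ht, ht']
    | tmul u v => simp [haarAux_transpose]
  have h := key (coproduct q (transpose q x))
  rw [← coproduct_transpose, transpose_transpose, haarAux_id_conv, haarAux_transpose] at h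
  rw [h, map_smul, map_one]

theorem exists_haarState : ∃ h : OSUq q →ₗ[ℂ] ℂ, IsHaarState q h :=
  ⟨haarAux q, haarAux_one q, haarAux_pos q, haarAux_id_conv q, haarAux_conv_id q⟩

end

/-- The Haar state `h` of quantum `SU(2)`. -/
noncomputable def haarState (q : ℝ) [hq : Fact (0 < q ∧ q < 1)] : OSUq q →ₗ[ℂ] ℂ :=
  Classical.choose (exists_haarState q)

section
variable (q : ℝ) [hq : Fact (0 < q ∧ q < 1)]

theorem haarState_isHaarState : IsHaarState q (haarState q) :=
  Classical.choose_spec (exists_haarState q)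

variable {q} in
/-- There is only one Haar state. -/
theorem IsHaarState.unique {h h' : OSUq q →ₗ[ℂ] ℂ} (H : IsHaarState q h) (H' : IsHaarState q h') :
    h = h' := by
  have key : ∀ t : OSUq q ⊗[ℂ] OSUq q, h' (TensorProduct.rid ℂ (OSUq q) (h.lTensor (OSUq q) t)) =
      h (TensorProduct.lid ℂ (OSUq q) (h'.rTensor (OSUq q) t)) := by
    intro t
    induction t using TensorProduct.induction_on with
    | zero => simp
    | add t t' ht ht' => simp only [map_add, ht, ht']
    | tmul u v => simp [mul_comm]
  ext x
  have hx := key (coproduct q x)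
  rw [H.id_conv, H'.conv_id, map_smul, map_smul, H.map_one, H'.map_one] at hx
  simpa using hx

theorem haarState_eq : haarState q = haarAux q :=
  (haarState_isHaarState q).unique
    ⟨haarAux_one q, haarAux_pos q, haarAux_id_conv q, haarAux_conv_id q⟩

end

/-! ### The GNS space -/

/-- The coordinate algebra with the inner product `⟨x, y⟩ = h(x* y)`. -/
def PreGNS (q : ℝ) : Type := OSUq q

noncomputable instance (q : ℝ) : AddCommGroup (PreGNS q) := inferInstanceAs (AddCommGroup (OSUq q))
noncomputable instance (q : ℝ) : Module ℂ (PreGNS q) := inferInstanceAs (Module ℂ (OSUq q))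

/-- The identity map from the coordinate algebra to `PreGNS`. -/
noncomputable def toPreGNS (q : ℝ) : OSUq q ≃ₗ[ℂ] PreGNS q := LinearEquiv.refl ℂ (OSUq q)

section
variable (q : ℝ) [hq : Fact (0 < q ∧ q < 1)]

noncomputable abbrev preGNSCore : PreInnerProductSpace.Core ℂ (PreGNS q) where
  inner x y := haarState q (star ((toPreGNS q).symm x) * (toPreGNS q).symm y)
  conj_inner_symm x y := by
    rw [← (haarState_isHaarState q).pos.map_star, star_mul, star_star]
  re_inner_nonneg x :=
    (Complex.nonneg_iff.1 ((haarState_isHaarState q).pos ((toPreGNS q).symm x))).1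
  add_left x y z := by rw [map_add, star_add, add_mul, map_add]
  smul_left x y t := by
    rw [map_smul, star_smul, smul_mul_assoc, map_smul, smul_eq_mul, Complex.star_def]

noncomputable instance : SeminormedAddCommGroup (PreGNS q) :=
  InnerProductSpace.Core.toSeminormedAddCommGroup (c := preGNSCore q)
noncomputable instance : InnerProductSpace ℂ (PreGNS q) := InnerProductSpace.ofCore (preGNSCore q)

theorem preGNS_inner (x y : OSUq q) :
    inner ℂ (toPreGNS q x) (toPreGNS q y) = haarState q (star x * y) := rfl

/-- The GNS space `H_h` of the Haar state: the completion of the coordinate algebra. -/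
abbrev GNS : Type := UniformSpace.Completion (PreGNS q)

/-- The canonical map from the coordinate algebra to `H_h`. -/
noncomputable def toGNS : OSUq q →ₗ[ℂ] GNS q :=
  (UniformSpace.Completion.toComplₗᵢ (𝕜 := ℂ) (E := PreGNS q)).toLinearMap ∘ₗ
    (toPreGNS q).toLinearMap

theorem inner_toGNS (x y : OSUq q) :
    inner ℂ (toGNS q x) (toGNS q y) = haarState q (star x * y) :=
  UniformSpace.Completion.inner_coe (𝕜 := ℂ) (toPreGNS q x) (toPreGNS q y)

theorem denseRange_toGNS : DenseRange (toGNS q) := by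
  have h := UniformSpace.Completion.denseRange_coe (α := PreGNS q)
  exact h

theorem exists_norm_bound (x : OSUq q) :
    ∃ C : ℝ, ∀ y : OSUq q, ‖toPreGNS q (x * y)‖ ≤ C * ‖toPreGNS q y‖ := by
  obtain ⟨C, hC, H⟩ := exists_bound x
  refine ⟨√C, fun y => ?_⟩
  have h1 := H _ (haarState_isHaarState q).pos y
  rw [← preGNS_inner, ← preGNS_inner] at h1
  have e : ∀ z : PreGNS q, (inner ℂ z z : ℂ).re = ‖z‖ ^ 2 := fun z => by
    rw [inner_self_eq_norm_sq_to_K]; norm_cast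
  rw [e, e] at h1
  rw [← abs_of_nonneg (norm_nonneg (toPreGNS q (x * y))), ← Real.sqrt_sq_eq_abs,
    ← Real.sqrt_sq (norm_nonneg (toPreGNS q y)), ← Real.sqrt_mul hC]
  exact Real.sqrt_le_sqrt h1

/-- Left multiplication by `x` as a bounded operator on `PreGNS`. -/
noncomputable def preLeftMul (x : OSUq q) : PreGNS q →L[ℂ] PreGNS q :=
  LinearMap.mkContinuousOfExistsBound
    ((toPreGNS q).toLinearMap ∘ₗ LinearMap.mulLeft ℂ x ∘ₗ (toPreGNS q).symm.toLinearMap)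
    ((exists_norm_bound q x).imp fun _ hC y => hC ((toPreGNS q).symm y))

/-- The representation `π` on `H_h`: `π(x)` is the bounded extension of left multiplication
by `x`. -/
noncomputable def leftMul (x : OSUq q) : GNS q →L[ℂ] GNS q := (preLeftMul q x).completion

theorem leftMul_toGNS (x y : OSUq q) : leftMul q x (toGNS q y) = toGNS q (x * y) :=
  ContinuousLinearMap.completion_apply_coe (preLeftMul q x) (toPreGNS q y)

/-! ### The Dirac operator -/

/-- The Hilbert space `H = H_h ⊕ H_h`. -/
abbrev HSpace : Type := PiLp 2 (fun _ : Fin 2 => GNS q)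

/-- The bounded operator on `H_h ⊕ H_h` given by a `2 × 2` matrix of bounded operators. -/
noncomputable def opMatrix (M : Matrix (Fin 2) (Fin 2) (GNS q →L[ℂ] GNS q)) :
    HSpace q →L[ℂ] HSpace q :=
  (PiLp.continuousLinearEquiv 2 ℂ (fun _ : Fin 2 => GNS q)).symm.toContinuousLinearMap ∘L
    ContinuousLinearMap.pi fun i => ∑ j, M i j ∘L PiLp.proj 2 (fun _ : Fin 2 => GNS q) j

theorem opMatrix_apply (M : Matrix (Fin 2) (Fin 2) (GNS q →L[ℂ] GNS q)) (ξ : HSpace q)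
    (i : Fin 2) : opMatrix q M ξ i = ∑ j, M i j (ξ j) := by
  simp [opMatrix]

/-- The representation of the coordinate algebra on `H_h ⊕ H_h` by diagonal left multiplication
operators. -/
noncomputable def diagRep (x : OSUq q) : HSpace q →L[ℂ] HSpace q :=
  opMatrix q !![leftMul q x, 0; 0, leftMul q x]

/-- The canonical map from `O(SU_q(2)) ⊕ O(SU_q(2))` to `H_h ⊕ H_h`. -/
noncomputable def toHSpace : (Fin 2 → OSUq q) →ₗ[ℂ] HSpace q :=
  (WithLp.linearEquiv 2 ℂ (Fin 2 → GNS q)).symm.toLinearMap ∘ₗ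
    LinearMap.pi fun i => toGNS q ∘ₗ LinearMap.proj i

theorem toHSpace_apply (ξ : Fin 2 → OSUq q) (i : Fin 2) : toHSpace q ξ i = toGNS q (ξ i) := rfl

/-- The matrix over `U_q(su_2)`
`[[(q⁻¹ k² - 1)/(q - q⁻¹), q^{1/2} e k], [q^{-1/2} f k, (1 - q k²)/(q - q⁻¹)]]`. -/
noncomputable def diracMatrix : Matrix (Fin 2) (Fin 2) (Uq q) :=
  !![((q : ℂ) - (q : ℂ)⁻¹)⁻¹ • ((q : ℂ)⁻¹ • Uq.k q ^ 2 - 1), qHalf q • (Uq.e q * Uq.k q);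
    (qHalf q)⁻¹ • (Uq.f q * Uq.k q), ((q : ℂ) - (q : ℂ)⁻¹)⁻¹ • (1 - (q : ℂ) • Uq.k q ^ 2)]

/-- The action of the above matrix on `O(SU_q(2)) ⊕ O(SU_q(2))`. -/
noncomputable def diracAlg : (Fin 2 → OSUq q) →ₗ[ℂ] (Fin 2 → OSUq q) :=
  LinearMap.pi fun i => ∑ j, leftAction q (diracMatrix q i j) ∘ₗ LinearMap.proj j

theorem diracAlg_apply (ξ : Fin 2 → OSUq q) (i : Fin 2) :
    diracAlg q ξ i = ∑ j, leftAction q (diracMatrix q i j) (ξ j) := by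
  simp [diracAlg]

/-- The unbounded operator `D` on `H_h ⊕ H_h` with domain `O(SU_q(2)) ⊕ O(SU_q(2))`,
given by its graph. -/
noncomputable def preDirac : HSpace q →ₗ.[ℂ] HSpace q :=
  (LinearMap.range ((toHSpace q).prod (toHSpace q ∘ₗ diracAlg q))).toLinearPMap

theorem haarState_adj_K (x y : OSUq q) :
    haarState q (star (actK q x) * y) = haarState q (star x * actK q y) := by
  rw [← actKinv_star, haarState_eq, ← haarAux_actK, map_mul, actK_actKinv]

theorem haarState_adj_E (x y : OSUq q) :
    haarState q (star (actE q x) * y) = haarState q (star x * actF q y) := by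
  have hqne := q_ne q
  have h := haarAux_actF q (star x * actK q y)
  have h2 : haarAux q (actK q (star x) * actF q (actK q y)) =
      (q : ℂ) * haarAux q (star x * actF q y) := by
    have e : actF q (actK q y) = actK q ((q : ℂ) • actF q y) := by
      rw [map_smul, actK_actF, smul_smul, mul_inv_cancel₀ hqne, one_smul]
    rw [e, ← map_mul, haarAux_actK, mul_smul_comm, map_smul, smul_eq_mul]
  rw [actF_mul, actKinv_actK, actF_star, map_add, smul_mul_assoc, map_smul, h2, smul_eq_mul] at h
  rw [haarState_eq]
  apply mul_left_cancel₀ hqne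
  linear_combination -h

theorem haarState_adj_F (x y : OSUq q) :
    haarState q (star (actF q x) * y) = haarState q (star x * actE q y) := by
  have h := haarState_adj_E q y x
  have hstar := (haarState_isHaarState q).pos.map_star
  have h' := congrArg conj h
  rw [← hstar, ← hstar, star_mul, star_mul, star_star, star_star] at h'
  exact h'.symm

/-- `D` is symmetric. -/
theorem dirac_symm (ξ η : Fin 2 → OSUq q) :
    inner ℂ (toHSpace q (diracAlg q ξ)) (toHSpace q η) =
      inner ℂ (toHSpace q ξ) (toHSpace q (diracAlg q η)) := by
  have hqne := q_ne q
  have hs := qHalf_ne q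
  have hcs : conj (qHalf q) = qHalf q := by simp [qHalf]
  have hsq : qHalf q * (q : ℂ)⁻¹ = (qHalf q)⁻¹ := by rw [qHalf_mul q]; field_simp
  have hsq' : (qHalf q)⁻¹ * (q : ℂ) = qHalf q := by rw [qHalf_mul q]; field_simp
  simp only [PiLp.inner_apply, Fin.sum_univ_two, toHSpace_apply, inner_toGNS]
  simp only [diracAlg_apply, Fin.sum_univ_two, diracMatrix, Matrix.of_apply, Matrix.cons_val', Matrix.cons_val_zero, Matrix.cons_val_one,
    Matrix.cons_val_fin_one, map_smul, map_sub, map_mul, map_one, leftAction_e,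
    leftAction_f, leftAction_k, LinearMap.smul_apply, LinearMap.sub_apply, Module.End.mul_apply,
    Module.End.one_apply, pow_two, AlgHom.toLinearMap_apply, star_add, star_sub, star_smul, add_mul,
    sub_mul, mul_add, mul_sub, smul_mul_assoc, mul_smul_comm, map_add, smul_eq_mul,
    Complex.star_def, map_inv₀, Complex.conj_ofReal, hcs, haarState_adj_K, haarState_adj_E,
    haarState_adj_F, actK_actE, actK_actF]
  linear_combination
    (hsq) * haarState q (star (ξ 1) * actF q (actK q (η 0))) +
    (hsq') * haarState q (star (ξ 0) * actE q (actK q (η 1)))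

theorem denseRange_toHSpace : DenseRange (toHSpace q) := by
  have h : DenseRange (Pi.map (fun _ : Fin 2 => toGNS q)) :=
    DenseRange.piMap fun _ => denseRange_toGNS q
  exact (PiLp.homeomorph 2 (fun _ : Fin 2 => GNS q)).symm.surjective.denseRange.comp h
    (PiLp.homeomorph 2 (fun _ : Fin 2 => GNS q)).symm.continuous

theorem diracGraph_closure {p : HSpace q × HSpace q}
    (hp : p ∈ (LinearMap.range
      ((toHSpace q).prod (toHSpace q ∘ₗ diracAlg q))).topologicalClosure) (h0 : p.1 = 0) :
    p.2 = 0 := by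
  have key : ∀ η, inner ℂ p.2 (toHSpace q η) = inner ℂ p.1 (toHSpace q (diracAlg q η)) := by
    intro η
    have hc : IsClosed {p : HSpace q × HSpace q |
        inner ℂ p.2 (toHSpace q η) = inner ℂ p.1 (toHSpace q (diracAlg q η))} :=
      isClosed_eq (continuous_snd.inner continuous_const) (continuous_fst.inner continuous_const)
    refine closure_minimal ?_ hc hp
    rintro _ ⟨ξ, rfl⟩
    exact dirac_symm q ξ η
  refine (denseRange_toHSpace q).eq_zero_of_inner_left (𝕜 := ℂ) ?_
  intro η
  simpa [h0] using key η

theorem preDirac_graph : (preDirac q).graph =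
    LinearMap.range ((toHSpace q).prod (toHSpace q ∘ₗ diracAlg q)) :=
  Submodule.toLinearPMap_graph_eq _ fun _ hp h0 =>
    diracGraph_closure q (Submodule.le_topologicalClosure _ hp) h0

theorem preDirac_isClosable : (preDirac q).IsClosable :=
  ⟨(LinearMap.range
      ((toHSpace q).prod (toHSpace q ∘ₗ diracAlg q))).topologicalClosure.toLinearPMap, by
    rw [preDirac_graph]
    exact (Submodule.toLinearPMap_graph_eq _ fun _ hp h0 => diracGraph_closure q hp h0).symm⟩

/-- The `q`-Dirac operator `D_q`: the closure of `D`. -/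
noncomputable def dirac : HSpace q →ₗ.[ℂ] HSpace q := (preDirac q).closure

end

/-- The twisted commutator `D T - S D` of an unbounded operator `D` with bounded operators `T, S`,
on its natural domain `{ξ ∈ Dom D | T ξ ∈ Dom D}`. -/
noncomputable def twistedCommutator {H : Type*} [NormedAddCommGroup H] [InnerProductSpace ℂ H]
    (D : H →ₗ.[ℂ] H) (T S : H →L[ℂ] H) : H →ₗ.[ℂ] H where
  domain := D.domain ⊓ D.domain.comap T.toLinearMap
  toFun := D.toFun ∘ₗ (T.toLinearMap.restrict (p := D.domain ⊓ D.domain.comap T.toLinearMap) (q := D.domain)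
      fun _ hξ => hξ.2) -
    S.toLinearMap ∘ₗ D.toFun ∘ₗ Submodule.inclusion inf_le_left

theorem twistedCommutator_apply {H : Type*} [NormedAddCommGroup H] [InnerProductSpace ℂ H]
    (D : H →ₗ.[ℂ] H) (T S : H →L[ℂ] H) (ξ : (twistedCommutator D T S).domain) :
    twistedCommutator D T S ξ = D ⟨T ξ, ξ.2.2⟩ - S (D ⟨ξ, ξ.2.1⟩) := rfl

end SUq2

open SUq2

/-! The theorem combines an algebraic identity with a closure argument.

On the algebra, every entry of the matrix that defines `D` obeys a Leibniz rule twisted by `σ_L` on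
the left, up to a multiple of `x` in the diagonal entries. For the off-diagonal entries, take `g =
e` or `g = f`. Since `∂_k` is multiplicative, `∂_{gk}(xy) = ∂_g(∂_k(x) ∂_k(y))`, and the twisted
Leibniz rule for `g` turns this into `∂_{gk}(x) ∂_{k⁻¹}(∂_k(y)) + ∂_{k²}(x) ∂_{gk}(y)`. The right
factor `k` has two effects: it cancels the `k⁻¹` acting on `y`, so that the first term is
multiplication by an element of the algebra, and it completes the coefficient of the second term to
`σ_L(x)`. A diagonal entry has the form `α ∂_{k²} + β` with scalars `α` and `β`. Because `∂_{k²} =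
σ_L` is an algebra automorphism, the `α`-part satisfies `σ_L(xy) = σ_L(x) σ_L(y)` and drops out of
the twisted commutator. Only `β (x - σ_L(x)) y` remains. With `β = -(q - q⁻¹)⁻¹` in the upper corner
and `β = (q - q⁻¹)⁻¹` in the lower one, this gives `∂_{k²-1}(x)` with opposite signs, and the
different weights `q⁻¹` and `q` in front of `k²` leave no trace. The differences thus involve no
derivative of `y`. They are left multiplications, which are bounded on the GNS space. This is
`diracAlg_mul`.

To pass to `D_q`, the identity is read as a statement about graphs. Write `C` for the bounded matrix
of left multiplications. The map `(ξ, η) ↦ (xξ, σ_L(x)η + Cξ)` is continuous on `H × H` and sends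
the graph of `D` into itself, hence sends the closure of that graph into itself
(`diagRep_mem_dirac_graph`). By `dirac_graph` the closure is the graph of `D_q`. This rests on the
closability of `D`, which follows from its symmetry for the Haar inner product and the density of
the algebra. The first coordinate of the invariance shows that `x` preserves `Dom(D_q)`, so the
natural domain of the twisted commutator is not smaller than `Dom(D_q)`. The second coordinate,
together with the single-valuedness of a graph, gives the formula on all of that domain. -/

namespace SUq2

/-! ### The twisted Leibniz identity on the algebraic domain. -/

section
variable (q : ℝ) [hq : Fact (0 < q ∧ q < 1)]

/-- The matrix of left multiplications representing the twisted commutator of `D_q` with `x`. -/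
noncomputable def commutatorOp (x : OSUq q) : HSpace q →L[ℂ] HSpace q :=
  opMatrix q
    !![((q : ℂ) - (q : ℂ)⁻¹)⁻¹ • leftMul q (leftAction q (Uq.k q ^ 2 - 1) x),
        qHalf q • leftMul q (leftAction q (Uq.e q * Uq.k q) x);
      (qHalf q)⁻¹ • leftMul q (leftAction q (Uq.f q * Uq.k q) x),
        -(((q : ℂ) - (q : ℂ)⁻¹)⁻¹ • leftMul q (leftAction q (Uq.k q ^ 2 - 1) x))]

/-- The bounded operators are defined on the completion by extension. On the image of the algebra
they reduce to multiplication, which is what allows a computation in `OSUq q` to be transported to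
the Hilbert space. It also shows that the algebraic domain is stable under `x`. -/
theorem diagRep_toHSpace (x : OSUq q) (ξ : Fin 2 → OSUq q) :
    diagRep q x (toHSpace q ξ) = toHSpace q fun i => x * ξ i := by
  ext i
  fin_cases i <;> simp [diagRep, opMatrix_apply, toHSpace_apply, leftMul_toGNS]

/-- The twisted commutator on the algebraic domain `O(SU_q(2)) ⊕ O(SU_q(2))`. -/
theorem diracAlg_mul (x : OSUq q) (ξ : Fin 2 → OSUq q) :
    toHSpace q (diracAlg q fun i => x * ξ i) =
      diagRep q (sigmaL q x) (toHSpace q (diracAlg q ξ)) +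
        commutatorOp q x (toHSpace q ξ) := by
  -- Once the `σ_L(x)` term is an image of an algebra vector, only the matrix term still contains
  -- operators on the completion. That term is expanded entry by entry below.
  rw [diagRep_toHSpace]
  ext i
  fin_cases i <;>
    simp only [Fin.zero_eta, Fin.mk_one, PiLp.add_apply, commutatorOp, opMatrix_apply,
      toHSpace_apply, Fin.sum_univ_two, Matrix.of_apply, Matrix.cons_val', Matrix.cons_val_zero,
      Matrix.cons_val_one, Matrix.cons_val_fin_one, smul_apply, neg_apply, leftMul_toGNS, ← map_smul, ← map_add, ← map_neg] <;>
    -- Both sides are now single values of `toGNS`, because the sums and scalars have been pulled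
    -- inside. It suffices to compare the arguments in the algebra, so neither injectivity of
    -- `toGNS` nor faithfulness of the Haar state is needed.
    congr 1 <;>
    -- The Leibniz rules are applied to `∂_k(x) ∂_k(y)`. Here `actKinv_actK` removes the inverse
    -- that would otherwise act on `y`, and `k²` is written as two applications of `actK` so that
    -- both occurrences of `σ_L` take the same form.
    simp only [diracAlg_apply, diracMatrix, Fin.sum_univ_two, Matrix.of_apply, Matrix.cons_val',
      Matrix.cons_val_zero, Matrix.cons_val_one, Matrix.cons_val_fin_one, map_smul, map_sub,
      map_mul, map_one, leftAction_e, leftAction_f, leftAction_k, LinearMap.smul_apply,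
      LinearMap.sub_apply, Module.End.mul_apply, Module.End.one_apply, pow_two,
      AlgHom.toLinearMap_apply, sigmaL_apply, actE_mul, actF_mul, actKinv_actK,
      mul_add, mul_sub, sub_mul, mul_smul_comm, smul_add, smul_sub] <;>
    -- What remains is linear over `ℂ` in the products of algebra elements. The terms `σ_L(x)
    -- σ_L(y)` and `σ_L(x) ∂_{gk}(y)` occur with equal coefficients on the two sides, and so do the
    -- terms `σ_L(x) y`, once those coming from the `σ_L`-multiple of `D` and from the matrix are
    -- collected. The factor `(q - q⁻¹)⁻¹` enters only as a common scalar, so its denominator never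
    -- has to be cleared.
    module

/-! ### Passage from the algebraic graph to its closure. -/

/-- Closability is essential here: `LinearPMap.closure` returns the operator itself when no closure
exists. Given closability, membership in the graph of `D_q` becomes a topological condition on pairs
coming from the algebra, so it can be handled by continuity and density without choosing
approximating sequences. -/
theorem dirac_graph : (dirac q).graph = (LinearMap.range
    ((toHSpace q).prod (toHSpace q ∘ₗ diracAlg q))).topologicalClosure := by
  rw [dirac, ← (preDirac_isClosable q).graph_closure_eq_closure_graph, preDirac_graph]

/-- Left multiplication preserves the graph of `D_q` up to the bounded twisted commutator. -/
theorem diagRep_mem_dirac_graph (x : OSUq q) {ξ η : HSpace q} (h : (ξ, η) ∈ (dirac q).graph) :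
    (diagRep q x ξ, diagRep q (sigmaL q x) η + commutatorOp q x ξ) ∈ (dirac q).graph := by
  rw [dirac_graph] at h ⊢
  -- The second coordinate is the value that `D_q(xξ)` must have when `η = D_q ξ`. As a map of pairs
  -- it is defined on all of `H × H` and involves bounded operators only, whereas the same
  -- expression with `D_q ξ` in place of `η` would not be continuous in `ξ`.
  let Φ : HSpace q × HSpace q → HSpace q × HSpace q :=
    fun p => (diagRep q x p.1, diagRep q (sigmaL q x) p.2 + commutatorOp q x p.1)
  have hΦ : Continuous Φ := by fun_prop
  -- A continuous map that sends a set into itself also sends its closure into itself, so only pairs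
  -- `(ζ, Dζ)` with `ζ` in the algebraic domain have to be checked.
  refine map_mem_closure (f := Φ) hΦ h ?_
  rintro _ ⟨ζ, rfl⟩
  -- The image pair is the graph point over `xζ`: its first coordinate by the action on algebra
  -- vectors, its second by the twisted Leibniz identity.
  exact ⟨fun i => x * ζ i, Prod.ext (diagRep_toHSpace q x ζ).symm (diracAlg_mul q x ζ)⟩

/-- The invariance of the graph produces an explicit second coordinate over `xξ`, and the existence
of any such coordinate is exactly membership in the domain. -/
theorem diagRep_mem_dirac_domain (x : OSUq q) {ξ : HSpace q} (h : ξ ∈ (dirac q).domain) :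
    diagRep q x ξ ∈ (dirac q).domain :=
  LinearPMap.mem_domain_of_mem_graph
    (diagRep_mem_dirac_graph q x ((dirac q).mem_graph ⟨ξ, h⟩))

/-- The domain contains the image of two copies of the algebra, which is dense because the GNS space
is a completion of the algebra. -/
theorem dense_dirac_domain : Dense ((dirac q).domain : Set (HSpace q)) := by
  refine (denseRange_toHSpace q).mono ?_
  rintro _ ⟨ζ, rfl⟩
  have h : (toHSpace q ζ, toHSpace q (diracAlg q ζ)) ∈ (dirac q).graph := by
    rw [dirac_graph]
    exact Submodule.le_topologicalClosure _ ⟨ζ, rfl⟩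
  exact LinearPMap.mem_domain_of_mem_graph h

end

end SUq2

/-! ### The domain and the value of the twisted commutator. -/

theorem lemma3p2 (q : ℝ) [Fact (0 < q ∧ q < 1)] (x : OSUq q) :
    (twistedCommutator (dirac q) (diagRep q x) (diagRep q (sigmaL q x))).domain =
        (dirac q).domain ∧
      Dense ((dirac q).domain : Set (HSpace q)) ∧
      ∀ ξ : (twistedCommutator (dirac q) (diagRep q x) (diagRep q (sigmaL q x))).domain,
        twistedCommutator (dirac q) (diagRep q x) (diagRep q (sigmaL q x)) ξ =
          opMatrix q
            !![((q : ℂ) - (q : ℂ)⁻¹)⁻¹ • leftMul q (leftAction q (Uq.k q ^ 2 - 1) x),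
                qHalf q • leftMul q (leftAction q (Uq.e q * Uq.k q) x);
              (qHalf q)⁻¹ • leftMul q (leftAction q (Uq.f q * Uq.k q) x),
                -(((q : ℂ) - (q : ℂ)⁻¹)⁻¹ • leftMul q (leftAction q (Uq.k q ^ 2 - 1) x))] ξ := by
  -- The natural domain is by definition the intersection of `Dom(D_q)` with its preimage under `x`,
  -- and stability under `x` makes the second condition automatic.
  refine ⟨inf_eq_left.2 fun ξ hξ => diagRep_mem_dirac_domain q x hξ, dense_dirac_domain q,
    fun ξ => ?_⟩
  -- Moving `σ_L(x) D_q ξ` to the right gives the goal the shape of the second coordinate in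
  -- `diagRep_mem_dirac_graph`. The explicit matrix is `commutatorOp` unfolded.
  rw [twistedCommutator_apply, sub_eq_iff_eq_add']
  -- Two points of the graph of `D_q` lie over `xξ`: the one given by the value of `D_q` there, and
  -- the one obtained by transporting `(ξ, D_q ξ)`. A graph is single-valued, so their second
  -- coordinates agree.
  exact (dirac q).mem_graph_snd_inj ((dirac q).mem_graph ⟨_, ξ.2.2⟩)
    (diagRep_mem_dirac_graph q x ((dirac q).mem_graph ⟨ξ, ξ.2.1⟩)) rfl
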